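/- Let $\mathfrak{d}=\mathrm{Der}(\mathbb{C}[t^{\pm1}])$, let $\partial=t\frac{d}{dt}$ and $L_m=-t^m\partial$ ($m\in\mathbb{Z}$), and let $\hat{\mathfrak{d}}=\mathfrak{d}\oplus\mathbb{C}K$ be the complex Virasoro algebra, in which $K$ is central and $[L_m,L_n]=(m-n)L_{m+n}+\frac{1}{12}(m^3-m)\delta_{m,-n}K$. For $m\neq 0$ put $\mathfrak{z}(m)=\mathrm{span}_{\mathbb{C}}\{\partial,t^m\partial\}\subseteq\mathfrak{d}$. Let $\Sigma$ be the set of all quadruples $\mu=(n,k,\mathbf{r},\mathbf{a})$ where $1\le k\le n$ are integers; $\mathbf{r}=(r_1,\dots,r_n)$ with $r_1,\dots,r_k$ positive integers, $r_{k+1}=\dots=r_n=-1$ and $|\mathbf{r}|:=r_1+\dots+r_n\ge k$; and $\mathbf{a}=(a_1,\dots,a_n)$ is a tuple of nonzero complex numbers with $\sum_{j=1}^n r_ja_j^i=0$ for $i=1,\dots,n-1$. For $\mu\in\Sigma$ put $$P_\mu=\prod_{j=1}^n(t-a_j),\qquad Q_\mu=t^{-|\mathbf{r}|}\prod_{j=1}^k(t-a_j)^{r_j+1},\qquad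 \mathfrak{s}(\mu)=\mathrm{span}_{\mathbb{C}}\{P_\mu\partial,Q_\mu\partial\}\subseteq\mathfrak{d}.$$ For every $\mu\in\Sigma$ there is exactly one pair $(\lambda,\beta_0)\in\mathbb{C}^2$ such that $[P_\mu\partial,Q_\mu\partial]=\lambda Q_\mu\partial+\lambda\beta_0K$ in $\hat{\mathfrak{d}}$; this defines $\beta_0=\beta_0(\mu)$. **Theorem.** Every finite-dimensional Lie subalgebra of $\hat{\mathfrak{d}}$ has dimension at most $4$. Moreover, for a linear subspace $\mathfrak{a}\subseteq\hat{\mathfrak{d}}$: 1. $\mathfrak{a}$ is a Lie subalgebra of dimension $1$ if and only if $\mathfrak{a}=\mathbb{C}X$ for some nonzero $X\in\hat{\mathfrak{d}}$. 2. $\mathfrak{a}$ is a Lie subalgebra of dimension $2$ if and only if it is one of: $\mathbb{C}X\oplus\mathbb{C}K$ for some nonzero $X\in\mathfrak{d}$; $\mathrm{span}_{\mathbb{C}}\{L_0+\alpha K,L_m\}$ for some $\alpha\in\mathbb{C}$ and some nonzero integer $m$; $\mathrm{span}_{\mathbb{C}}\{P_\mu\partial+\alpha K,Q_\mu\partial+\beta_0(\mu)K\}$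 for some $\mu\in\Sigma$ and $\alpha\in\mathbb{C}$. 3. $\mathfrak{a}$ is a Lie subalgebra of dimension $3$ if and only if it is one of: $\mathrm{span}_{\mathbb{C}}\{L_0+\frac{1}{24}(m^2-1)K,L_{-m},L_m\}$ for some nonzero integer $m$; $\mathfrak{z}(m)\oplus\mathbb{C}K$ for some nonzero integer $m$; $\mathfrak{s}(\mu)\oplus\mathbb{C}K$ for some $\mu\in\Sigma$. 4. $\mathfrak{a}$ is a Lie subalgebra of dimension $4$ if and only if $\mathfrak{a}=\mathrm{span}_{\mathbb{C}}\{L_0,L_{-m},L_m,K\}$ for some nonzero integer $m$. -/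

import Mathlib

open scoped LaurentPolynomial
open LaurentPolynomial (T)

namespace Virasoro

noncomputable section

/-- The Lie algebra `𝔡` of derivations of the Laurent polynomial algebra `ℂ[t, t⁻¹]`. -/
abbrev Witt : Type := Derivation ℂ ℂ[T;T⁻¹] ℂ[T;T⁻¹]

/-- The linear map `t ^ n ↦ n t ^ n` on Laurent polynomials. -/
def degLin : ℂ[T;T⁻¹] →ₗ[ℂ] ℂ[T;T⁻¹] :=
  (AddMonoidAlgebra.basis ℤ ℂ).constr ℂ fun n : ℤ => (n : ℂ) • (T n : ℂ[T;T⁻¹])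

lemma degLin_T (n : ℤ) : degLin (T n) = (n : ℂ) • (T n : ℂ[T;T⁻¹]) := by
  have h : (T n : ℂ[T;T⁻¹]) = AddMonoidAlgebra.basis ℤ ℂ n := by
    rfl
  conv_lhs => rw [h]
  exact Module.Basis.constr_basis _ _ _ _

lemma linear_ext {M : Type*} [AddCommGroup M] [Module ℂ M] {f g : ℂ[T;T⁻¹] →ₗ[ℂ] M}
    (h : ∀ n : ℤ, f (T n) = g (T n)) : f = g := by
  refine (AddMonoidAlgebra.basis ℤ ℂ).ext fun n => ?_
  have hn : AddMonoidAlgebra.basis ℤ ℂ n = (T n : ℂ[T;T⁻¹]) := by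
    rfl
  rw [hn, h n]

lemma degLin_mul (p q : ℂ[T;T⁻¹]) : degLin (p * q) = p • degLin q + q • degLin p := by
  have h : (LinearMap.mul ℂ ℂ[T;T⁻¹]).compr₂ degLin =
      (LinearMap.mul ℂ ℂ[T;T⁻¹]).compl₂ degLin +
        ((LinearMap.mul ℂ ℂ[T;T⁻¹]).compl₂ degLin).flip := by
    refine linear_ext fun m => linear_ext fun n => ?_
    simp only [LinearMap.compr₂_apply, LinearMap.add_apply, LinearMap.compl₂_apply,
      LinearMap.flip_apply, LinearMap.mul_apply', degLin_T]
    rw [← LaurentPolynomial.T_add, degLin_T, mul_smul_comm, mul_smul_comm,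
      ← LaurentPolynomial.T_add, ← LaurentPolynomial.T_add, add_comm n m, ← add_smul]
    push_cast
    rw [add_comm (m : ℂ)]
  have := congrArg (fun l => l p q) h
  simpa using this

/-- The degree operator `∂ = t d/dt`, as an element of `𝔡`. -/
def del : Witt := Derivation.mk' degLin degLin_mul

lemma del_T (n : ℤ) : del (T n) = (n : ℂ) • (T n : ℂ[T;T⁻¹]) := degLin_T n

/-- The Laurent polynomial `F` with `D = F ∂`, namely `F = t⁻¹ D(t)`. -/
def coord : Witt →ₗ[ℂ] ℂ[T;T⁻¹] where
  toFun D := T (-1) * D (T 1)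
  map_add' D E := by simp [mul_add]
  map_smul' c D := by simp

lemma coord_smul_del (F : ℂ[T;T⁻¹]) : coord (F • del) = F := by
  have h : (T (-1) : ℂ[T;T⁻¹]) * T 1 = 1 := by rw [← LaurentPolynomial.T_add]; simp
  change T (-1) * (F * del (T 1)) = F
  rw [del_T, Int.cast_one, one_smul, mul_left_comm, h, mul_one]

lemma apply_T (D : Witt) (n : ℤ) : D (T n) = (n : ℂ) • (coord D * T n) := by
  let φ : ℤ →+ ℂ[T;T⁻¹] :=
    { toFun := fun n => T (-n) * D (T n)
      map_zero' := by simp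
      map_add' := fun m n => by
        have hm : (T (-m) : ℂ[T;T⁻¹]) * T m = 1 := by rw [← LaurentPolynomial.T_add]; simp
        have hn : (T (-n) : ℂ[T;T⁻¹]) * T n = 1 := by rw [← LaurentPolynomial.T_add]; simp
        rw [LaurentPolynomial.T_add m n, neg_add, LaurentPolynomial.T_add, D.leibniz]
        simp only [smul_eq_mul]
        linear_combination (T (-n) * D (T n)) * hm + (T (-m) * D (T m)) * hn }
  have h1 : φ n = n • φ 1 := by rw [← map_zsmul]; simp
  have hn : (T (-n) : ℂ[T;T⁻¹]) * T n = 1 := by rw [← LaurentPolynomial.T_add]; simp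
  have h2 : T (-n) * D (T n) = n • coord D := h1
  rw [Int.cast_smul_eq_zsmul, ← smul_mul_assoc, ← h2]
  linear_combination (-D (T n)) * hn

/-- Every derivation is uniquely of the form `F ∂`. -/
lemma coord_smul (D : Witt) : coord D • del = D := by
  have h : ((coord D • del : Witt) : ℂ[T;T⁻¹] →ₗ[ℂ] ℂ[T;T⁻¹]) = (D : ℂ[T;T⁻¹] →ₗ[ℂ] ℂ[T;T⁻¹]) := by
    refine linear_ext fun n => ?_
    change coord D * del (T n) = D (T n)
    rw [apply_T D n, del_T, mul_smul_comm]
  exact Derivation.ext fun p => congrArg (fun l => l p) h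

lemma coord_lie (D E : Witt) :
    coord ⁅D, E⁆ = coord D * del (coord E) - coord E * del (coord D) := by
  have h : (T (-1) : ℂ[T;T⁻¹]) * T 1 = 1 := by rw [← LaurentPolynomial.T_add]; simp
  have key : ∀ D E : Witt, D (E (T 1)) = coord D * (del (coord E) + coord E) * T 1 := by
    intro D E
    rw [apply_T E 1, Int.cast_one, one_smul]
    conv_lhs => rw [← coord_smul D]
    change coord D * del (coord E * T 1) = _
    rw [del.leibniz, del_T]
    simp only [smul_eq_mul, Int.cast_one, one_smul]
    ring
  change T (-1) * ⁅D, E⁆ (T 1) = _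
  rw [Derivation.commutator_apply, key, key]
  linear_combination (coord D * del (coord E) - coord E * del (coord D)) * h

/-- The coefficient of `t ^ 0`. -/
def const : ℂ[T;T⁻¹] →ₗ[ℂ] ℂ where
  toFun p := p.coeff 0
  map_add' _ _ := by simp
  map_smul' _ _ := by simp

lemma const_T (n : ℤ) : const (T n) = if n = 0 then 1 else 0 :=
  LaurentPolynomial.T_apply 0 n

lemma const_del (p : ℂ[T;T⁻¹]) : const (del p) = 0 := by
  have h : const ∘ₗ degLin = 0 := by
    refine linear_ext fun n => ?_
    rw [LinearMap.comp_apply, degLin_T, map_smul, const_T]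
    split_ifs with hn <;> simp [hn]
  exact congrArg (fun l => l p) h

/-- The bilinear form `(F ∂, G ∂) ↦ (1 / 12) ∑ₘ (m ^ 3 - m) Fₘ G₋ₘ` on `𝔡`, written as the
constant term of `(1 / 12) ((∂ ^ 3 - ∂) F) G`. -/
def form : Witt →ₗ[ℂ] Witt →ₗ[ℂ] ℂ :=
  (1 / 12 : ℂ) • ((LinearMap.mul ℂ ℂ[T;T⁻¹]).compr₂ const).compl₁₂
    ((degLin ∘ₗ degLin ∘ₗ degLin - degLin) ∘ₗ coord) coord

lemma form_apply (D E : Witt) : form D E =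
    (1 / 12 : ℂ) * const ((del (del (del (coord D))) - del (coord D)) * coord E) := rfl

lemma form_self (D : Witt) : form D D = 0 := by
  rw [form_apply]
  set f := coord D
  have h : (2 : ℂ) • ((del (del (del f)) - del f) * f) =
      del (del (del f) * f + del (del f) * f - del f * del f - f * f) := by
    simp only [map_sub, map_add, Derivation.leibniz, smul_eq_mul, two_smul]
    ring
  have h2 := congrArg const h
  rw [const_del, map_smul, smul_eq_zero] at h2
  rw [h2.resolve_left two_ne_zero, mul_zero]

lemma form_cocycle (D E G : Witt) : form D ⁅E, G⁆ = form ⁅D, E⁆ G + form E ⁅D, G⁆ := by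
  rw [form_apply, form_apply, form_apply, ← mul_add, ← map_add, coord_lie, coord_lie, coord_lie]
  congr 1
  rw [← sub_eq_zero, ← map_sub]
  set f := coord D
  set g := coord E
  set h := coord G
  rw [← const_del (del (del (del f)) * g * h - f * del (del (del g)) * h - del f * g * h
    + f * del g * h)]
  congr 1
  simp only [map_sub, map_add, Derivation.leibniz, smul_eq_mul]
  ring

/-- `form` as a `2`-cocycle of `𝔡` with values in the trivial module `ℂ`. -/
def cocycle : LieModule.Cohomology.twoCocycle ℂ Witt (TrivialLieModule ℂ Witt ℂ) :=
  ⟨⟨form.compr₂ (TrivialLieModule.equiv ℂ Witt ℂ).symm.toLinearMap, form_self⟩,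
    (LieModule.Cohomology.mem_twoCocycle_iff_of_trivial _ _ _ _).2 form_cocycle⟩

/-- The Virasoro algebra `𝔡 ⊕ ℂ K`: the central extension of `𝔡` by the `2`-cocycle `cocycle`. -/
abbrev Vir : Type := LieAlgebra.ofTwoCocycle cocycle

/-- The inclusion of the vector space `𝔡` in `𝔡 ⊕ ℂ K`. -/
def incl : Witt →ₗ[ℂ] Vir where
  toFun D := LieAlgebra.ofProd cocycle (D, 0)
  map_add' D E := by rw [← LieAlgebra.of_add]; simp
  map_smul' c D := by rw [RingHom.id_apply, ← LieAlgebra.of_smul]; simp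

/-- The central element `K`. -/
def K : Vir := LieAlgebra.ofProd cocycle (0, (TrivialLieModule.equiv ℂ Witt ℂ).symm 1)

/-- The basis elements `L_m = - t ^ m ∂`. -/
def L (m : ℤ) : Vir := incl (-((T m : ℂ[T;T⁻¹]) • del))

lemma lie_incl (D E : Witt) : ⁅incl D, incl E⁆ = incl ⁅D, E⁆ + form D E • K := by
  rw [LieAlgebra.bracket_ofTwoCocycle]
  simp only [incl, K, LinearMap.coe_mk, AddHom.coe_mk, Equiv.symm_apply_apply]
  rw [← LieAlgebra.of_smul, ← LieAlgebra.of_add]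
  congr 1
  refine Prod.ext ?_ ?_
  · simp
  · simp only [lie_zero, add_zero, sub_zero, Prod.snd_add, Prod.smul_snd, zero_add, ← map_smul,
      smul_eq_mul, mul_one]
    rfl

/-- `K` is central. -/
lemma lie_K (x : Vir) : ⁅x, K⁆ = 0 := by
  rw [LieAlgebra.bracket_ofTwoCocycle, K]
  simp only [Equiv.symm_apply_apply, lie_zero, map_zero, LieModule.IsTrivial.trivial, sub_zero,
    add_zero]
  rfl

/-- The relations `[L_m, L_n] = (m - n) L_{m+n} + (1 / 12) (m ^ 3 - m) δ_{m,-n} K`. -/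
lemma lie_L (m n : ℤ) : ⁅L m, L n⁆ =
    ((m : ℂ) - n) • L (m + n) + (if m = -n then (1 / 12 : ℂ) * ((m : ℂ) ^ 3 - m) else 0) • K := by
  have hc : ∀ k : ℤ, coord (-((T k : ℂ[T;T⁻¹]) • del)) = -T k := fun k => by
    rw [map_neg, coord_smul_del]
  rw [L, L, lie_incl, L, ← map_smul]
  congr 2
  · rw [← coord_smul ⁅_, _⁆, coord_lie, hc, hc, map_neg, map_neg, del_T, del_T, smul_neg,
      ← smul_assoc, ← neg_smul (_ : ℂ[T;T⁻¹]) del]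
    congr 1
    rw [LaurentPolynomial.T_add, ← mul_smul_comm]
    simp only [LaurentPolynomial.smul_eq_C_mul, map_sub]
    ring
  · rw [form_apply, hc, hc]
    simp only [map_neg, del_T, Derivation.map_smul]
    have h0 : const ((T m : ℂ[T;T⁻¹]) * T n) = if m = -n then 1 else 0 := by
      rw [← LaurentPolynomial.T_add, const_T]
      simp only [eq_neg_iff_add_eq_zero]
    have : (-((m : ℂ) • (m : ℂ) • (m : ℂ) • (T m : ℂ[T;T⁻¹])) - -((m : ℂ) • T m)) * -T n =
        ((m : ℂ) ^ 3 - m) • ((T m : ℂ[T;T⁻¹]) * T n) := by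
      simp only [smul_smul, sub_smul, ← neg_smul, mul_neg, sub_mul, smul_mul_assoc]
      rw [neg_sub, neg_smul, neg_smul, sub_neg_eq_add, neg_add_eq_sub]
      congr 2
      ring
    rw [this, map_smul, h0]
    split_ifs <;> simp

/-- The subspace `𝔷(m) = span {∂, t ^ m ∂}` of `𝔡`. -/
def z (m : ℤ) : Submodule ℂ Witt := Submodule.span ℂ {del, (T m : ℂ[T;T⁻¹]) • del}

/-- The set `Γ(n, k)` of all `r ∈ ℕ^k × {-1}^(n-k)` (with `ℕ = {1, 2, …}`) satisfying
`r₁ + ⋯ + rₙ ≥ k`. -/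
def Gam (n k : ℕ) : Set (Fin n → ℤ) :=
  {r | (∀ j, j.val < k → 1 ≤ r j) ∧ (∀ j, k ≤ j.val → r j = -1) ∧ (k : ℤ) ≤ ∑ j, r j}

/-- The set `V(r)^×` of all `a ∈ (ℂ^×)^n` with `∑ⱼ rⱼ aⱼ ^ i = 0` for `i = 1, …, n - 1`. -/
def Vset {n : ℕ} (r : Fin n → ℤ) : Set (Fin n → ℂ) :=
  {a | (∀ i : ℕ, 1 ≤ i → i < n → ∑ j, (r j : ℂ) * a j ^ i = 0) ∧ ∀ j, a j ≠ 0}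

/-- The set `Σ` of all quadruples `μ = (n, k, r, a)` with `1 ≤ k ≤ n`, `r ∈ Γ(n, k)` and
`a ∈ V(r)^×`. -/
structure Param where
  n : ℕ
  k : ℕ
  one_le_k : 1 ≤ k
  k_le_n : k ≤ n
  r : Fin n → ℤ
  r_mem : r ∈ Gam n k
  a : Fin n → ℂ
  a_mem : a ∈ Vset r

/-- `P_μ = (t - a₁) ⋯ (t - aₙ)`. -/
def Param.P (μ : Param) : ℂ[T;T⁻¹] := ∏ j, (T 1 - LaurentPolynomial.C (μ.a j))

/-- `Q_μ = t ^ (-|r|) (t - a₁) ^ (r₁ + 1) ⋯ (t - aₖ) ^ (rₖ + 1)`; here `rⱼ + 1 ≥ 2`, so `toNat`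
does not truncate. -/
def Param.Q (μ : Param) : ℂ[T;T⁻¹] :=
  T (-∑ j, μ.r j) *
    ∏ j with j.val < μ.k, (T 1 - LaurentPolynomial.C (μ.a j)) ^ (μ.r j + 1).toNat

/-- The subspace `𝔰(μ) = span {P_μ ∂, Q_μ ∂}` of `𝔡`. -/
def s (μ : Param) : Submodule ℂ Witt := Submodule.span ℂ {μ.P • del, μ.Q • del}

/-- The subspace `W` of the Virasoro algebra is (the underlying space of) a Lie subalgebra of
dimension `d`. -/
def IsSubalgebraOfDim (d : ℕ) (W : Submodule ℂ Vir) : Prop :=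
  (∃ b : LieSubalgebra ℂ Vir, b.toSubmodule = W) ∧ Module.finrank ℂ W = d

end

end Virasoro

/-! Writing a vector field as `f ∂` turns the bracket of `𝔡` into `wr f g = f ∂g - g ∂f`, and the
projection of the Virasoro algebra onto `𝔡` has kernel `ℂ K`. So the subalgebras of `𝔡` are
classified first and then lifted.

If `f` and `g` have distinct highest exponents `p` and `q`, then `wr f g` has highest exponent `p +
q` (`HasTop.wr`). The highest exponents of a finite-dimensional subalgebra thus form a finite set
closed under sums of distinct elements. Such a set has at most one positive and at most one negative
element (`subset_of_add_mem`), whence dimension at most 3. In dimension 3, comparison with the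
lowest exponents forces the monomials `t ^ (-m)`, `1`, `t ^ m`.

A two-dimensional subalgebra is not abelian, so it has a basis with `[f ∂, g ∂] = λ g ∂` and `λ ≠
0`. Subtracting multiples of `g` from `f` makes the highest, or the lowest, exponent of `f` equal to
0. If a constant arises, `g` is a monomial. Otherwise, clearing the pole of order `e` of `g` leaves
`X (p q' - q p') = (λ + e p) q` for polynomials. Its local analysis shows that `p` has simple roots
`a_j`, and that `q` vanishes only at these, to orders `r_j + 1 ≠ 1`. Division by `p q` gives `∑ r_j
a_j / (X - a_j) = λ / p` with `∑ r_j = e`. The numerator on the left is constant exactly when the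
power sums in the definition of `Σ` vanish (`residueNum_eq_C_iff`).

A subalgebra containing `K` is the full preimage of its projection. Any other is isomorphic to its
projection, and brackets inside it determine the central components of elements of its derived
algebra; only in dimension 2 does one scalar `α` stay free. -/

namespace Virasoro

noncomputable section

/-! ### Leading exponents of Laurent polynomials -/

/-- The coefficient of `t ^ n`, as a linear form. -/
def coeffLin (n : ℤ) : ℂ[T;T⁻¹] →ₗ[ℂ] ℂ where
  toFun p := p.coeff n
  map_add' _ _ := by simp
  map_smul' _ _ := by simp

lemma coeff_del (f : ℂ[T;T⁻¹]) (n : ℤ) : (del f).coeff n = n * f.coeff n := by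
  have h : coeffLin n ∘ₗ degLin = (n : ℂ) • coeffLin n := by
    refine linear_ext fun m => ?_
    rw [LinearMap.comp_apply, degLin_T, map_smul, LinearMap.smul_apply]
    change (m : ℂ) • (T m : ℂ[T;T⁻¹]).coeff n = (n : ℂ) • (T m : ℂ[T;T⁻¹]).coeff n
    rw [LaurentPolynomial.T_apply]
    split_ifs with hm <;> simp [hm]
  exact congrArg (fun l => l f) h

lemma invert_del (f : ℂ[T;T⁻¹]) :
    LaurentPolynomial.invert (del f) = -del (LaurentPolynomial.invert f) := by
  refine LaurentPolynomial.ext fun n => ?_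
  simp [coeff_del]

/-- The bracket of `𝔡` in coordinates: `[f ∂, g ∂] = wr f g ∂`. -/
def wr (f g : ℂ[T;T⁻¹]) : ℂ[T;T⁻¹] := f * del g - g * del f

lemma coord_lie_eq_wr (D E : Witt) : coord ⁅D, E⁆ = wr (coord D) (coord E) := coord_lie D E

lemma wr_add_left (f g h : ℂ[T;T⁻¹]) : wr (f + g) h = wr f h + wr g h := by
  simp only [wr, map_add]; ring

lemma wr_smul_left (c : ℂ) (f h : ℂ[T;T⁻¹]) : wr (c • f) h = c • wr f h := by
  simp only [wr, Derivation.map_smul, smul_mul_assoc, mul_smul_comm, smul_sub]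

lemma wr_self (f : ℂ[T;T⁻¹]) : wr f f = 0 := by simp [wr]

lemma wr_skew (f g : ℂ[T;T⁻¹]) : wr g f = -wr f g := by simp [wr]

lemma wr_add_right (f g h : ℂ[T;T⁻¹]) : wr f (g + h) = wr f g + wr f h := by
  simp only [wr, map_add]; ring

lemma wr_smul_right (c : ℂ) (f h : ℂ[T;T⁻¹]) : wr f (c • h) = c • wr f h := by
  simp only [wr, Derivation.map_smul, smul_mul_assoc, mul_smul_comm, smul_sub]

lemma wr_T (m n : ℤ) : wr (T m) (T n) = ((n : ℂ) - m) • (T (m + n) : ℂ[T;T⁻¹]) := by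
  rw [wr, del_T, del_T, mul_smul_comm, mul_smul_comm, ← LaurentPolynomial.T_add,
    ← LaurentPolynomial.T_add, add_comm n m, sub_smul]

/-- The substitution `t ↦ t⁻¹` preserves subalgebras and exchanges highest and lowest exponents, so
each fact about the former yields one about the latter. -/
lemma invert_wr (f g : ℂ[T;T⁻¹]) : LaurentPolynomial.invert (wr f g) =
    -wr (LaurentPolynomial.invert f) (LaurentPolynomial.invert g) := by
  simp only [wr, map_sub, map_mul, invert_del]; ring

/-- `t ^ p` is the highest power of `t` in `f`. -/
def HasTop (f : ℂ[T;T⁻¹]) (p : ℤ) : Prop := f.coeff p ≠ 0 ∧ ∀ n, p < n → f.coeff n = 0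

/-- `t ^ p` is the lowest power of `t` in `f`. -/
def HasBot (f : ℂ[T;T⁻¹]) (p : ℤ) : Prop := f.coeff p ≠ 0 ∧ ∀ n, n < p → f.coeff n = 0

lemma exists_hasTop {f : ℂ[T;T⁻¹]} (hf : f ≠ 0) : ∃ p, HasTop f p := by
  have hs : f.coeff.support.Nonempty := by
    rw [Finsupp.support_nonempty_iff]
    exact fun h => hf (AddMonoidAlgebra.coeff_eq_zero.1 h)
  refine ⟨f.coeff.support.max' hs, Finsupp.mem_support_iff.1 (Finset.max'_mem _ hs), fun n hn => ?_⟩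
  by_contra h
  exact absurd (Finset.le_max' _ n (Finsupp.mem_support_iff.2 h)) (not_le.2 hn)

lemma hasTop_invert {f : ℂ[T;T⁻¹]} {p : ℤ} :
    HasTop (LaurentPolynomial.invert f) p ↔ HasBot f (-p) := by
  simp only [HasTop, HasBot, LaurentPolynomial.invert_apply]
  refine and_congr_right fun _ => ⟨fun h n hn => ?_, fun h n hn => h _ (by lia)⟩
  simpa using h (-n) (by lia)

lemma exists_hasBot {f : ℂ[T;T⁻¹]} (hf : f ≠ 0) : ∃ p, HasBot f p := by
  have hf' : LaurentPolynomial.invert f ≠ 0 := by simpa using hf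
  obtain ⟨p, hp⟩ := exists_hasTop hf'
  exact ⟨-p, hasTop_invert.1 hp⟩

lemma HasTop.unique {f : ℂ[T;T⁻¹]} {p q : ℤ} (hp : HasTop f p) (hq : HasTop f q) : p = q := by
  rcases lt_trichotomy p q with h | h | h
  · exact absurd (hp.2 q h) hq.1
  · exact h
  · exact absurd (hq.2 p h) hp.1

/-- Upper bounds on the exponents replace `HasTop` because `∂` kills a leading term of exponent 0.
-/
lemma coeff_mul_add {f g : ℂ[T;T⁻¹]} {p q : ℤ} (hf : ∀ n, p < n → f.coeff n = 0)
    (hg : ∀ n, q < n → g.coeff n = 0) : (f * g).coeff (p + q) = f.coeff p * g.coeff q := by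
  rw [AddMonoidAlgebra.coeff_mul_apply_left, Finsupp.sum]
  rw [Finset.sum_eq_single p]
  · simp
  · intro b hb hbp
    rcases lt_or_gt_of_ne hbp with h | h
    · rw [hg _ (by lia), mul_zero]
    · rw [hf _ h, zero_mul]
  · intro h
    rw [Finsupp.notMem_support_iff.1 h, zero_mul]

lemma coeff_mul_eq_zero {f g : ℂ[T;T⁻¹]} {p q : ℤ} (hf : ∀ n, p < n → f.coeff n = 0)
    (hg : ∀ n, q < n → g.coeff n = 0) {n : ℤ} (hn : p + q < n) : (f * g).coeff n = 0 := by
  rw [AddMonoidAlgebra.coeff_mul_apply_left, Finsupp.sum]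
  refine Finset.sum_eq_zero fun b _ => ?_
  rcases le_or_gt b p with h | h
  · rw [hg _ (by lia), mul_zero]
  · rw [hf _ h, zero_mul]

/-- The coefficient at `p + q` is `q - p` times the product of the leading coefficients. -/
lemma HasTop.wr {f g : ℂ[T;T⁻¹]} {p q : ℤ} (hf : HasTop f p) (hg : HasTop g q) (hpq : p ≠ q) :
    HasTop (wr f g) (p + q) := by
  have hdf : ∀ n, p < n → (del f).coeff n = 0 := fun n hn => by rw [coeff_del, hf.2 n hn, mul_zero]
  have hdg : ∀ n, q < n → (del g).coeff n = 0 := fun n hn => by rw [coeff_del, hg.2 n hn, mul_zero]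
  constructor
  · have : (Virasoro.wr f g).coeff (p + q) = ((q : ℂ) - p) * (f.coeff p * g.coeff q) := by
      change (f * del g - g * del f).coeff (p + q) = _
      rw [AddMonoidAlgebra.coeff_sub, Finsupp.sub_apply, coeff_mul_add hf.2 hdg, add_comm p q,
        coeff_mul_add hg.2 hdf, coeff_del, coeff_del]
      ring
    rw [this]
    refine mul_ne_zero (sub_ne_zero.2 ?_) (mul_ne_zero hf.1 hg.1)
    exact_mod_cast hpq.symm
  · intro n hn
    change (f * del g - g * del f).coeff n = _
    rw [AddMonoidAlgebra.coeff_sub, Finsupp.sub_apply, coeff_mul_eq_zero hf.2 hdg hn,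
      coeff_mul_eq_zero hg.2 hdf (by lia), sub_zero]

/-! ### Finite-dimensional subalgebras of `𝔡` in coordinates -/

/-- The subspace `V` of `ℂ[t, t⁻¹]` is closed under the bracket of `𝔡`. -/
def WrClosed (V : Submodule ℂ ℂ[T;T⁻¹]) : Prop := ∀ f ∈ V, ∀ g ∈ V, wr f g ∈ V

/-- The set of all leading exponents of elements of `V`. -/
def tops (V : Submodule ℂ ℂ[T;T⁻¹]) : Set ℤ := {p | ∃ f ∈ V, HasTop f p}

lemma tops_add {V : Submodule ℂ ℂ[T;T⁻¹]} (hV : WrClosed V) {p q : ℤ} (hp : p ∈ tops V)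
    (hq : q ∈ tops V) (hpq : p ≠ q) : p + q ∈ tops V := by
  obtain ⟨f, hf, hfp⟩ := hp
  obtain ⟨g, hg, hgq⟩ := hq
  exact ⟨_, hV f hf g hg, hfp.wr hgq hpq⟩

/-- An exponent occurring in some element of `V` occurs in one of finitely many generators. -/
lemma finite_tops (V : Submodule ℂ ℂ[T;T⁻¹]) [FiniteDimensional ℂ V] : (tops V).Finite := by
  obtain ⟨s, hs⟩ := Module.Finite.iff_fg.1 ‹FiniteDimensional ℂ V›
  refine (s.biUnion fun f => f.coeff.support).finite_toSet.subset ?_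
  rintro p ⟨f, hf, hp⟩
  by_contra hps
  have hle : V ≤ LinearMap.ker (coeffLin p) := by
    rw [← hs, Submodule.span_le]
    intro g hg
    by_contra hgp
    exact hps (Finset.mem_coe.2 (Finset.mem_biUnion.2 ⟨g, hg, Finsupp.mem_support_iff.2 hgp⟩))
  exact hp.1 (hle hf)

lemma eq_zero_of_coeff_tops {V : Submodule ℂ ℂ[T;T⁻¹]} {f : ℂ[T;T⁻¹]} (hf : f ∈ V)
    (h : ∀ p ∈ tops V, f.coeff p = 0) : f = 0 := by
  by_contra h0
  obtain ⟨p, hp⟩ := exists_hasTop h0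
  exact hp.1 (h p ⟨f, hf, hp⟩)

/-- Taking the coefficients at the exponents in `tops V` is injective on `V`: a nonzero element is
detected at its own highest exponent. -/
lemma finrank_le_ncard_tops (V : Submodule ℂ ℂ[T;T⁻¹]) [FiniteDimensional ℂ V] :
    Module.finrank ℂ V ≤ (tops V).ncard := by
  have := (finite_tops V).fintype
  let φ : V →ₗ[ℂ] (tops V → ℂ) := LinearMap.pi fun p => coeffLin p ∘ₗ V.subtype
  have hφ : Function.Injective φ := by
    rw [injective_iff_map_eq_zero]
    intro f hf
    refine Subtype.ext (eq_zero_of_coeff_tops f.2 fun p hp => ?_)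
    exact congrFun hf ⟨p, hp⟩
  have h := LinearMap.finrank_le_finrank_of_injective hφ
  rwa [Module.finrank_fintype_fun_eq_card, ← Nat.card_eq_fintype_card, Nat.card_coe_set_eq] at h

/-- A positive element other than the maximum `m`, added to `m`, would exceed `m`. The negative
elements are handled by applying this to `-S`. -/
lemma subset_of_add_mem {S : Set ℤ} (hS : S.Finite)
    (h : ∀ p ∈ S, ∀ q ∈ S, p ≠ q → p + q ∈ S) :
    ∃ a b : ℤ, 0 < a ∧ 0 < b ∧ S ⊆ {-a, 0, b} := by
  have key : ∀ S : Set ℤ, S.Finite → (∀ p ∈ S, ∀ q ∈ S, p ≠ q → p + q ∈ S) →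
      ∃ b : ℤ, 0 < b ∧ ∀ p ∈ S, 0 < p → p = b := by
    intro S hS h
    by_cases hne : ∃ p ∈ S, 0 < p
    · obtain ⟨p, hp, hp0⟩ := hne
      refine ⟨p, hp0, fun q hq hq0 => ?_⟩
      obtain ⟨m, hm, hmax⟩ := Set.exists_max_image S id hS ⟨p, hp⟩
      have hall : ∀ r ∈ S, 0 < r → r = m := fun r hr hr0 => by
        by_contra hrm
        have := hmax _ (h r hr m hm hrm)
        simp only [id] at this
        lia
      rw [hall q hq hq0, hall p hp hp0]
    · exact ⟨1, one_pos, fun p hp hp0 => absurd ⟨p, hp, hp0⟩ hne⟩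
  obtain ⟨b, hb, hSb⟩ := key S hS h
  obtain ⟨a, ha, hSa⟩ := key (-S) hS.neg fun p hp q hq hpq => by
    rw [Set.mem_neg, neg_add]
    exact h _ hp _ hq (by lia)
  refine ⟨a, b, ha, hb, fun p hp => ?_⟩
  rcases lt_trichotomy p 0 with h0 | h0 | h0
  · have := hSa (-p) (by simpa using hp) (by lia)
    simp only [Set.mem_insert_iff, Set.mem_singleton_iff]
    lia
  · simp [h0]
  · simp [hSb p hp h0]

lemma finrank_le_three {V : Submodule ℂ ℂ[T;T⁻¹]} [FiniteDimensional ℂ V] (hV : WrClosed V) :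
    Module.finrank ℂ V ≤ 3 := by
  obtain ⟨a, b, -, -, h⟩ := subset_of_add_mem (finite_tops V)
    fun p hp q hq hpq => tops_add hV hp hq hpq
  refine (finrank_le_ncard_tops V).trans ((Set.ncard_le_ncard h (Set.toFinite _)).trans ?_)
  exact (Set.ncard_insert_le _ _).trans
    (Nat.succ_le_succ (Set.ncard_insert_le _ _ |>.trans (by simp)))

lemma tops_eq_of_finrank {V : Submodule ℂ ℂ[T;T⁻¹]} [FiniteDimensional ℂ V] (hV : WrClosed V)
    (h3 : Module.finrank ℂ V = 3) : ∃ m : ℤ, 0 < m ∧ tops V = {-m, 0, m} := by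
  obtain ⟨a, b, ha, hb, h⟩ := subset_of_add_mem (finite_tops V)
    fun p hp q hq hpq => tops_add hV hp hq hpq
  have hcard : ({-a, 0, b} : Set ℤ).ncard ≤ 3 :=
    (Set.ncard_insert_le _ _).trans
    (Nat.succ_le_succ (Set.ncard_insert_le _ _ |>.trans (by simp)))
  have heq : tops V = {-a, 0, b} := Set.eq_of_subset_of_ncard_le h
    (hcard.trans (h3 ▸ finrank_le_ncard_tops V)) (Set.toFinite _)
  -- Since `a` and `b` are positive, `-a + b` can equal neither `-a` nor `b`, so it is 0.
  have hab := tops_add hV (p := -a) (q := b) (by simp [heq]) (by simp [heq]) (by lia)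
  rw [heq] at hab
  simp only [Set.mem_insert_iff, Set.mem_singleton_iff] at hab
  have : a = b := by lia
  exact ⟨b, hb, by rw [heq, this]⟩

/-! ### Three-dimensional subalgebras of `𝔡` -/

lemma WrClosed.map_invert {V : Submodule ℂ ℂ[T;T⁻¹]} (hV : WrClosed V) :
    WrClosed (V.map (LaurentPolynomial.invert (R := ℂ)).toLinearMap) := by
  rintro _ ⟨f, hf, rfl⟩ _ ⟨g, hg, rfl⟩
  refine ⟨-wr f g, V.neg_mem (hV f hf g hg), ?_⟩
  simp [invert_wr]

lemma eq_smul_T {f : ℂ[T;T⁻¹]} {m : ℤ} (h : ∀ n, n ≠ m → f.coeff n = 0) :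
    f = f.coeff m • (T m : ℂ[T;T⁻¹]) := by
  refine LaurentPolynomial.ext fun n => ?_
  rw [AddMonoidAlgebra.coeff_smul_apply, LaurentPolynomial.T_apply]
  split_ifs with hn
  · simp [hn]
  · rw [h n (Ne.symm hn), smul_zero]

/-- The subalgebras of dimension `3` of `𝔡`. -/
lemma eq_span_of_finrank_three {V : Submodule ℂ ℂ[T;T⁻¹]} [FiniteDimensional ℂ V]
    (hV : WrClosed V) (h3 : Module.finrank ℂ V = 3) :
    ∃ m : ℤ, m ≠ 0 ∧ V = Submodule.span ℂ {T 0, T (-m), T m} := by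
  obtain ⟨m, hm, htop⟩ := tops_eq_of_finrank hV h3
  set V' := V.map (LaurentPolynomial.invert (R := ℂ)).toLinearMap with hV'
  have h3' : Module.finrank ℂ V' = 3 := by
    rw [← h3]
    exact LinearEquiv.finrank_map_eq (LaurentPolynomial.invert (R := ℂ)).toLinearEquiv V
  obtain ⟨m', hm', htop'⟩ := tops_eq_of_finrank hV.map_invert h3'
  have htopm : ∀ f ∈ V, ∀ n, m < n → f.coeff n = 0 := fun f hf n hn => by
    by_cases h0 : f = 0
    · simp [h0]
    obtain ⟨p, hp⟩ := exists_hasTop h0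
    have : p ∈ tops V := ⟨f, hf, hp⟩
    simp only [htop, Set.mem_insert_iff, Set.mem_singleton_iff] at this
    exact hp.2 n (by lia)
  have hbotm : ∀ f ∈ V, ∀ n, n < -m' → f.coeff n = 0 := fun f hf n hn => by
    by_cases h0 : f = 0
    · simp [h0]
    obtain ⟨p, hp⟩ := exists_hasBot h0
    have : -p ∈ tops V' :=
      ⟨_, ⟨f, hf, rfl⟩, hasTop_invert.2 (by simpa using hp)⟩
    simp only [hV', htop', Set.mem_insert_iff, Set.mem_singleton_iff] at this
    exact hp.2 n (by lia)
  obtain ⟨f, hf, hft⟩ : -m ∈ tops V := by simp [htop]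
  obtain ⟨_, ⟨g, hg, rfl⟩, hgt⟩ : -m' ∈ tops V' := by simp [hV', htop']
  have hgb : HasBot g m' := by simpa using hasTop_invert.1 hgt
  -- The element `f` with highest exponent `-m` has no exponent below `-m'`, and `g` with lowest
  -- exponent `m'` has none above `m`. Hence `m = m'`, and both are monomials.
  have h1 : ¬ -m < -m' := fun h => hft.1 (hbotm f hf _ h)
  have h2 : ¬ m < m' := fun h => hgb.1 (htopm g hg _ h)
  obtain rfl : m = m' := by lia
  have hTn : (T (-m) : ℂ[T;T⁻¹]) ∈ V := by
    rw [eq_smul_T (f := f) (m := -m)] at hf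
    · exact (V.smul_mem_iff hft.1).1 hf
    · intro n hn
      rcases lt_or_gt_of_ne hn with h | h
      · exact hbotm f hf n h
      · exact hft.2 n h
  have hTp : (T m : ℂ[T;T⁻¹]) ∈ V := by
    rw [eq_smul_T (f := g) (m := m)] at hg
    · exact (V.smul_mem_iff hgb.1).1 hg
    · intro n hn
      rcases lt_or_gt_of_ne hn with h | h
      · exact hgb.2 n h
      · exact htopm g hg n h
  have hT0 : (T 0 : ℂ[T;T⁻¹]) ∈ V := by
    have := hV _ hTn _ hTp
    rw [wr_T, neg_add_cancel] at this
    refine (V.smul_mem_iff ?_).1 this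
    push_cast
    have : (m : ℂ) ≠ 0 := by exact_mod_cast hm.ne'
    intro h
    apply this
    linear_combination h / 2
  refine ⟨m, hm.ne', le_antisymm (fun h hh => ?_) ?_⟩
  · have : h - h.coeff 0 • T 0 - h.coeff (-m) • T (-m) - h.coeff m • T m = 0 := by
      refine eq_zero_of_coeff_tops (V := V) (V.sub_mem (V.sub_mem (V.sub_mem hh
        (V.smul_mem _ hT0)) (V.smul_mem _ hTn)) (V.smul_mem _ hTp)) fun p hp => ?_
      have hmm : -m ≠ m := by lia
      simp only [htop, Set.mem_insert_iff, Set.mem_singleton_iff] at hp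
      rcases hp with rfl | rfl | rfl <;>
        simp [-LaurentPolynomial.T_zero, hm.ne', hm.ne, hmm, hmm.symm]
    rw [Submodule.mem_span_insert]
    refine ⟨h.coeff 0, h.coeff (-m) • T (-m) + h.coeff m • T m,
      Submodule.mem_span_pair.2 ⟨_, _, rfl⟩, ?_⟩
    linear_combination this
  · rw [Submodule.span_le]
    rintro x (rfl | rfl | rfl) <;> assumption

end

end Virasoro

namespace Virasoro

noncomputable section

open scoped Polynomial
open Polynomial (X C derivative)

/-! ### Power sums of the roots and partial fractions -/

/-- The logarithmic derivative of `∏ x_j ^ b_j`, cleared of denominators. The extra factor `∏ x_j`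
avoids division and the truncated exponents `b_j - 1`. -/
lemma prod_mul_derivation_prod_pow {A ι : Type*} [CommRing A] [Algebra ℂ A] [DecidableEq ι]
    (D : Derivation ℂ A A) (s : Finset ι) (x : ι → A) (b : ι → ℕ) :
    (∏ j ∈ s, x j) * D (∏ j ∈ s, x j ^ b j) =
      (∑ j ∈ s, (b j : A) * (D (x j) * ∏ l ∈ s.erase j, x l)) * ∏ j ∈ s, x j ^ b j := by
  induction s using Finset.induction_on with
  | empty => simp
  | insert i s hi ih =>
    have h1 : ∀ j ∈ s, (b j : A) * (D (x j) * ∏ l ∈ (insert i s).erase j, x l) =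
        x i * ((b j : A) * (D (x j) * ∏ l ∈ s.erase j, x l)) := fun j hj => by
      have hij : i ≠ j := fun h => hi (h ▸ hj)
      rw [Finset.erase_insert_of_ne hij, Finset.prod_insert (fun h => hi (Finset.mem_of_mem_erase h))]
      ring
    have h2 : x i * D (x i ^ b i) = b i * D (x i) * x i ^ b i := by
      rw [D.leibniz_pow]
      rcases Nat.eq_zero_or_pos (b i) with h | h
      · simp [h]
      · obtain ⟨c, hc⟩ := Nat.exists_eq_succ_of_ne_zero h.ne'
        rw [hc]
        simp only [Nat.succ_eq_add_one, Nat.add_sub_cancel, smul_eq_mul, nsmul_eq_mul, pow_succ]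
        ring
    rw [Finset.sum_insert hi, Finset.sum_congr rfl h1, ← Finset.mul_sum, Finset.prod_insert hi,
      Finset.prod_insert hi, Finset.erase_insert hi, D.leibniz]
    simp only [smul_eq_mul]
    linear_combination (x i * x i ^ b i) * ih +
      (∏ j ∈ s, x j) * (∏ j ∈ s, x j ^ b j) * h2

lemma derivation_prod {A ι : Type*} [CommRing A] [Algebra ℂ A] [DecidableEq ι]
    (D : Derivation ℂ A A) (s : Finset ι) (x : ι → A) :
    D (∏ j ∈ s, x j) = ∑ j ∈ s, D (x j) * ∏ l ∈ s.erase j, x l := by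
  induction s using Finset.induction_on with
  | empty => simp
  | insert i s hi ih =>
    have h1 : ∀ j ∈ s, D (x j) * ∏ l ∈ (insert i s).erase j, x l =
        x i * (D (x j) * ∏ l ∈ s.erase j, x l) := fun j hj => by
      have hij : i ≠ j := fun h => hi (h ▸ hj)
      rw [Finset.erase_insert_of_ne hij, Finset.prod_insert (fun h => hi (Finset.mem_of_mem_erase h))]
      ring
    rw [Finset.sum_insert hi, Finset.sum_congr rfl h1, ← Finset.mul_sum, Finset.prod_insert hi,
      Finset.erase_insert hi, D.leibniz, ih]
    simp only [smul_eq_mul]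
    ring

/-- The coefficients of a quotient by `X - a`. -/
lemma coeff_of_eq_X_sub_C_mul {f q : ℂ[X]} {a : ℂ} (h : f = (X - C a) * q) {n : ℕ}
    (hq : q.natDegree < n) (l : ℕ) :
    q.coeff l = ∑ i ∈ Finset.range n, f.coeff (l + 1 + i) * a ^ i := by
  -- Each coefficient of `f` is a difference of neighbouring terms `q_i - a q_(i+1)`, so the
  -- weighted sum telescopes.
  have key : ∀ n, ∑ i ∈ Finset.range n, f.coeff (l + 1 + i) * a ^ i =
      q.coeff l - a ^ n * q.coeff (l + n) := fun n => by
    induction n with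
    | zero => simp
    | succ n ih =>
      have hc : f.coeff (l + 1 + n) = q.coeff (l + n) - a * q.coeff (l + n + 1) := by
        rw [h, sub_mul, Polynomial.coeff_sub, Polynomial.coeff_C_mul,
          show l + 1 + n = l + n + 1 by ring, Polynomial.coeff_X_mul]
      rw [Finset.sum_range_succ, ih, hc, ← add_assoc]
      ring
  rw [key, Polynomial.coeff_eq_zero_of_natDegree_lt (n := l + n) (by lia)]
  ring

variable {n : ℕ}

/-- The monic polynomial with the roots `a j`. -/
def nodal (a : Fin n → ℂ) : ℂ[X] := ∏ j, (X - C (a j))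

/-- The numerator of the partial fraction sum of all `r j * a j / (X - a j)`. -/
def residueNum (a : Fin n → ℂ) (r : Fin n → ℤ) : ℂ[X] :=
  ∑ j, C ((r j : ℂ) * a j) * ∏ l ∈ Finset.univ.erase j, (X - C (a l))

lemma natDegree_nodal (a : Fin n → ℂ) : (nodal a).natDegree = n := by
  rw [nodal, Polynomial.natDegree_prod_of_monic _ _ fun _ _ => Polynomial.monic_X_sub_C _]
  simp

lemma monic_nodal (a : Fin n → ℂ) : (nodal a).Monic :=
  Polynomial.monic_prod_of_monic _ _ fun _ _ => Polynomial.monic_X_sub_C _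

lemma nodal_eq_mul (a : Fin n → ℂ) (j : Fin n) :
    nodal a = (X - C (a j)) * ∏ l ∈ Finset.univ.erase j, (X - C (a l)) :=
  (Finset.mul_prod_erase _ _ (Finset.mem_univ j)).symm

/-- Dividing `nodal a` by `X - a j` gives coefficients polynomial in `a j`; summation over `j` turns
the powers of `a j` into weighted power sums. -/
lemma coeff_residueNum (a : Fin n → ℂ) (r : Fin n → ℤ) (l : ℕ) :
    (residueNum a r).coeff l =
      ∑ i ∈ Finset.range n, (nodal a).coeff (l + 1 + i) * ∑ j, (r j : ℂ) * a j ^ (i + 1) := by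
  have hj : ∀ j, (∏ l ∈ Finset.univ.erase j, (X - C (a l))).coeff l =
      ∑ i ∈ Finset.range n, (nodal a).coeff (l + 1 + i) * a j ^ i := fun j => by
    refine coeff_of_eq_X_sub_C_mul (nodal_eq_mul a j) ?_ l
    rw [Polynomial.natDegree_prod_of_monic _ _ fun _ _ => Polynomial.monic_X_sub_C _]
    have := j.pos
    simp only [Polynomial.natDegree_X_sub_C, Finset.sum_const, smul_eq_mul, mul_one,
      Finset.mem_univ, Finset.card_erase_of_mem, Finset.card_univ, Fintype.card_fin]
    lia
  simp only [residueNum, Polynomial.finsetSum_coeff, Polynomial.coeff_C_mul, hj, Finset.mul_sum]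
  rw [Finset.sum_comm]
  refine Finset.sum_congr rfl fun i _ => Finset.sum_congr rfl fun j _ => ?_
  ring

lemma coeff_nodal_of_lt (a : Fin n → ℂ) {m : ℕ} (h : n < m) : (nodal a).coeff m = 0 :=
  Polynomial.coeff_eq_zero_of_natDegree_lt (by rwa [natDegree_nodal])

lemma coeff_residueNum_of_le (a : Fin n → ℂ) (r : Fin n → ℤ) {l : ℕ} (h : n ≤ l) :
    (residueNum a r).coeff l = 0 := by
  rw [coeff_residueNum]
  exact Finset.sum_eq_zero fun i _ => by rw [coeff_nodal_of_lt a (by lia), zero_mul]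

/-- Because `nodal a` is monic, the coefficients in degrees `n - 1, …, 1` depend on the power sums
of orders `1, …, n - 1` by a unitriangular system. -/
lemma residueNum_eq_C_iff (a : Fin n → ℂ) (r : Fin n → ℤ) :
    (∃ c, residueNum a r = C c) ↔ ∀ i, 1 ≤ i → i < n → ∑ j, (r j : ℂ) * a j ^ i = 0 := by
  constructor
  · rintro ⟨c, hc⟩ i
    induction i using Nat.strong_induction_on with
    | _ i ih =>
      intro h1 hn
      have h := coeff_residueNum a r (n - i)
      rw [hc, Polynomial.coeff_C_of_ne_zero (by lia), Finset.sum_eq_single (i - 1)] at h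
      · rw [show n - i + 1 + (i - 1) = n by lia, show i - 1 + 1 = i by lia] at h
        have hlead : (nodal a).coeff n = 1 := by
          have := (monic_nodal a).coeff_natDegree
          rwa [natDegree_nodal] at this
        rw [hlead, one_mul] at h
        exact h.symm
      · intro b _ hb
        rcases lt_or_gt_of_ne hb with hlt | hgt
        · rw [ih (b + 1) (by lia) (by lia) (by lia), mul_zero]
        · rw [coeff_nodal_of_lt a (by lia), zero_mul]
      · intro h'
        exact absurd (Finset.mem_range.2 (by lia)) h'
  · intro h
    refine ⟨(residueNum a r).coeff 0, Polynomial.ext fun l => ?_⟩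
    rcases Nat.eq_zero_or_pos l with rfl | hl
    · simp
    rw [Polynomial.coeff_C_of_ne_zero hl.ne', coeff_residueNum]
    refine Finset.sum_eq_zero fun i hi => ?_
    have hi := Finset.mem_range.1 hi
    rcases Nat.lt_or_ge (i + 1) n with hlt | hge
    · rw [h (i + 1) (by lia) hlt, mul_zero]
    · rw [coeff_nodal_of_lt a (by lia), zero_mul]

/-- This is `r a / (X - a) + r = r X / (X - a)`, summed and cleared of denominators. -/
lemma residueNum_add (a : Fin n → ℂ) (r : Fin n → ℤ) :
    residueNum a r + C ((∑ j, r j : ℤ) : ℂ) * nodal a =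
      X * ∑ j, C (r j : ℂ) * ∏ l ∈ Finset.univ.erase j, (X - C (a l)) := by
  rw [residueNum, Int.cast_sum, map_sum, Finset.sum_mul, ← Finset.sum_add_distrib, Finset.mul_sum]
  refine Finset.sum_congr rfl fun j _ => ?_
  rw [nodal_eq_mul a j, map_mul]
  ring

/-! ### The polynomial form of `[f ∂, g ∂] = λ g ∂` -/

/-- Let `α`, `β` be the multiplicities at `a`. The left side is divisible by `(X - a) ^ (α + β -
1)`, with next coefficient proportional to `β - α`. If `α = 0`, the right side vanishes to order at
least `β`, so `β = 0`. If `α > 0`, then `f` vanishes at `a` and `λ ≠ 0` makes that order exactly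
`β`, which forces `α = 1` and then `β ≠ 1`. -/
lemma rootMultiplicity_of_wronskian {f g : ℂ[X]} {lam : ℂ} {e : ℕ} (hlam : lam ≠ 0)
    (h : X * (f * derivative g - g * derivative f) = (C lam + C (e : ℂ) * f) * g)
    (hf0 : f ≠ 0) (hg0 : g ≠ 0) {a : ℂ} (ha : a ≠ 0) :
    (f.rootMultiplicity a = 0 → g.rootMultiplicity a = 0) ∧
    (f.rootMultiplicity a ≠ 0 → f.rootMultiplicity a = 1 ∧ g.rootMultiplicity a ≠ 1) := by
  obtain ⟨u, hu, hua⟩ := f.exists_eq_pow_rootMultiplicity_mul_and_not_dvd hf0 a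
  obtain ⟨v, hv, hva⟩ := g.exists_eq_pow_rootMultiplicity_mul_and_not_dvd hg0 a
  rw [Polynomial.dvd_iff_isRoot, Polynomial.IsRoot.def] at hua hva
  set α := f.rootMultiplicity a
  set β := g.rootMultiplicity a
  have hpow : ∀ m : ℕ, (X - C a) * derivative ((X - C a) ^ m) = C (m : ℂ) * (X - C a) ^ m := by
    intro m
    rcases m with _ | m
    · simp
    · rw [Polynomial.derivative_X_sub_C_pow, Nat.add_sub_cancel, pow_succ]
      ring
  have hne : (X - C a : ℂ[X]) ≠ 0 := Polynomial.X_sub_C_ne_zero a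
  have key : X * ((X - C a) ^ α * ((C (β : ℂ) - C (α : ℂ)) * u * v +
      (X - C a) * (u * derivative v - v * derivative u))) =
      (X - C a) * ((C lam + C (e : ℂ) * f) * v) := by
    refine mul_left_cancel₀ (pow_ne_zero β hne) ?_
    have h' := congrArg (fun p => (X - C a) * p) h
    rw [hv] at h'
    nth_rewrite 1 2 [hu] at h'
    rw [Polynomial.derivative_mul, Polynomial.derivative_mul] at h'
    linear_combination h' - X * (X - C a) ^ α * u * v * hpow β + X * (X - C a) ^ β * u * v * hpow α
  constructor
  · intro hα
    have := congrArg (Polynomial.eval a) key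
    simpa [hα, ha, hua, hva] using this
  · intro hα
    obtain ⟨α', hα'⟩ := Nat.exists_eq_succ_of_ne_zero hα
    have hfa : f.eval a = 0 := by
      rw [hu, hα']; simp
    rw [hα', Nat.succ_eq_add_one] at key
    have key' : X * ((X - C a) ^ α' * ((C (β : ℂ) - C ((α' + 1 : ℕ) : ℂ)) * u * v +
        (X - C a) * (u * derivative v - v * derivative u))) = (C lam + C (e : ℂ) * f) * v := by
      refine mul_left_cancel₀ hne ?_
      rw [← key]
      ring
    have hev := congrArg (Polynomial.eval a) key'
    rcases α' with _ | α'
    · refine ⟨hα', fun hβ => ?_⟩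
      simp [hβ, hfa, hlam, hva] at hev
    · simp [hfa, hlam, hva] at hev

/-- `Param` lists the roots with positive `r j` before those with `r j = -1`. -/
lemma exists_sorted_enumeration (R : Finset ℂ) (p : ℂ → Prop) :
    ∃ (k l : ℕ) (a : Fin (k + l) → ℂ), Function.Injective a ∧
      Finset.univ.image a = R ∧ ∀ j, p (a j) ↔ j.val < k := by
  classical
  set A := R.filter p
  set B := R.filter fun x => ¬ p x
  have hA : ∀ i, (A.equivFin.symm i : ℂ) ∈ A := fun i => (A.equivFin.symm i).2
  have hB : ∀ i, (B.equivFin.symm i : ℂ) ∈ B := fun i => (B.equivFin.symm i).2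
  have hp : ∀ j, p (Fin.append (fun i => (A.equivFin.symm i : ℂ))
      (fun i => (B.equivFin.symm i : ℂ)) j) ↔ j.val < A.card := by
    intro j
    refine Fin.addCases (fun i => ?_) (fun i => ?_) j
    · simpa using (Finset.mem_filter.1 (hA i)).2
    · simpa using (Finset.mem_filter.1 (hB i)).2
  refine ⟨A.card, B.card, _, ?_, ?_, hp⟩
  · rw [Fin.append_injective_iff]
    refine ⟨Subtype.val_injective.comp A.equivFin.symm.injective,
      Subtype.val_injective.comp B.equivFin.symm.injective, fun i j h => ?_⟩
    exact (Finset.mem_filter.1 (hB j)).2 (h ▸ (Finset.mem_filter.1 (hA i)).2)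
  · ext x
    simp only [Finset.mem_image, Finset.mem_univ, true_and]
    constructor
    · rintro ⟨j, rfl⟩
      refine Fin.addCases (fun i => ?_) (fun i => ?_) j
      · simpa using (Finset.mem_filter.1 (hA i)).1
      · simpa using (Finset.mem_filter.1 (hB i)).1
    · intro hx
      by_cases hpx : p x
      · exact ⟨Fin.castAdd _ (A.equivFin ⟨x, Finset.mem_filter.2 ⟨hx, hpx⟩⟩), by simp⟩
      · exact ⟨Fin.natAdd _ (B.equivFin ⟨x, Finset.mem_filter.2 ⟨hx, hpx⟩⟩), by simp⟩

/-- Each root enters the difference of the two logarithmic derivatives with weight `b j - 1`, the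
future `r j`. -/
lemma wronskian_nodal (a : Fin n → ℂ) (b : Fin n → ℕ) :
    X * (nodal a * derivative (∏ j, (X - C (a j)) ^ b j) -
      (∏ j, (X - C (a j)) ^ b j) * derivative (nodal a)) =
    (residueNum a (fun j => (b j : ℤ) - 1) + C ((∑ j, ((b j : ℤ) - 1) : ℤ) : ℂ) * nodal a) *
      ∏ j, (X - C (a j)) ^ b j := by
  classical
  have h1 := prod_mul_derivation_prod_pow (Polynomial.derivative' (R := ℂ)) Finset.univ
    (fun j => X - C (a j)) b
  have h2 := derivation_prod (Polynomial.derivative' (R := ℂ)) Finset.univ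
    (fun j => X - C (a j))
  simp only [Polynomial.derivative'_apply, Polynomial.derivative_X_sub_C, one_mul] at h1 h2
  rw [residueNum_add, nodal, h1, h2]
  have : ∀ j, C (((b j : ℤ) - 1 : ℤ) : ℂ) = (b j : ℂ[X]) - 1 := fun j => by simp
  simp only [this, sub_mul, one_mul, Finset.sum_sub_distrib]
  ring

/-- The solutions of the polynomial form of `[f ∂, g ∂] = λ g ∂`. -/
lemma exists_of_wronskian {f g : ℂ[X]} {lam : ℂ} {e : ℕ} (hlam : lam ≠ 0)
    (h : X * (f * derivative g - g * derivative f) = (C lam + C (e : ℂ) * f) * g)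
    (hf : f.Monic) (hdeg : 0 < f.natDegree) (hf0 : f.coeff 0 ≠ 0)
    (hg0 : g.coeff 0 ≠ 0) :
    ∃ (k l : ℕ) (a : Fin (k + l) → ℂ) (b : Fin (k + l) → ℕ), Function.Injective a ∧
      (∀ j, a j ≠ 0) ∧ f = nodal a ∧ g = C g.leadingCoeff * ∏ j, (X - C (a j)) ^ b j ∧
      (∀ j, j.val < k → 2 ≤ b j) ∧ (∀ j, k ≤ j.val → b j = 0) ∧
      ∑ j, ((b j : ℤ) - 1) = e ∧
      ∀ i, 1 ≤ i → i < k + l → ∑ j, (((b j : ℤ) - 1 : ℤ) : ℂ) * a j ^ i = 0 := by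
  classical
  have hgne : g ≠ 0 := fun h0 => hg0 (by simp [h0])
  have hroot0 : ∀ a ∈ f.roots, a ≠ 0 := by
    rintro a ha rfl
    rw [Polynomial.mem_roots hf.ne_zero, Polynomial.IsRoot.def, ← Polynomial.coeff_zero_eq_eval_zero] at ha
    exact hf0 ha
  have hroot0' : ∀ a ∈ g.roots, a ≠ 0 := by
    rintro a ha rfl
    rw [Polynomial.mem_roots hgne, Polynomial.IsRoot.def, ← Polynomial.coeff_zero_eq_eval_zero] at ha
    exact hg0 ha
  have hmul := fun (a : ℂ) (ha : a ≠ 0) =>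
    rootMultiplicity_of_wronskian hlam h hf.ne_zero hgne ha
  have hfmult : ∀ a ∈ f.roots, f.rootMultiplicity a = 1 ∧ g.rootMultiplicity a ≠ 1 := fun a ha =>
    (hmul a (hroot0 a ha)).2 (by rwa [← Polynomial.count_roots, Multiset.count_ne_zero])
  have hsub : g.roots.toFinset ⊆ f.roots.toFinset := fun a ha => by
    rw [Multiset.mem_toFinset] at ha ⊢
    by_contra hfa
    rw [← Multiset.count_eq_zero, Polynomial.count_roots] at hfa
    have := (hmul a (hroot0' a ha)).1 hfa
    rw [← Polynomial.count_roots, Multiset.count_eq_zero] at this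
    exact this ha
  have hfprod : f = ∏ a ∈ f.roots.toFinset, (X - C a) := by
    conv_lhs => rw [(IsAlgClosed.splits f).eq_prod_roots_of_monic hf,
      Polynomial.prod_multiset_root_eq_finset_root]
    refine Finset.prod_congr rfl fun a ha => ?_
    rw [(hfmult a (Multiset.mem_toFinset.1 ha)).1, pow_one]
  have hgprod : g = C g.leadingCoeff *
      ∏ a ∈ f.roots.toFinset, (X - C a) ^ g.rootMultiplicity a := by
    conv_lhs => rw [(IsAlgClosed.splits g).eq_prod_roots,
      Polynomial.prod_multiset_root_eq_finset_root]
    congr 1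
    refine Finset.prod_subset hsub fun a _ ha => ?_
    rw [Multiset.mem_toFinset, ← Multiset.count_eq_zero, Polynomial.count_roots] at ha
    rw [ha, pow_zero]
  obtain ⟨k, l, a, hinj, himg, hk⟩ :=
    exists_sorted_enumeration f.roots.toFinset fun a => 2 ≤ g.rootMultiplicity a
  have hmem : ∀ j, a j ∈ f.roots := fun j => by
    rw [← Multiset.mem_toFinset, ← himg]
    exact Finset.mem_image_of_mem _ (Finset.mem_univ j)
  have hfa : f = nodal a := by
    conv_lhs => rw [hfprod, ← himg, Finset.prod_image hinj.injOn]
    rfl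
  have hga : g = C g.leadingCoeff * ∏ j, (X - C (a j)) ^ g.rootMultiplicity (a j) := by
    conv_lhs => rw [hgprod, ← himg, Finset.prod_image hinj.injOn]
  set b : Fin (k + l) → ℕ := fun j => g.rootMultiplicity (a j) with hb
  -- Cancelling `g` leaves an identity whose top coefficient gives `∑ r_j = e`; what remains says
  -- that the residue numerator is the constant `λ`.
  have hres : residueNum a (fun j => (b j : ℤ) - 1) +
      C ((∑ j, ((b j : ℤ) - 1) : ℤ) : ℂ) * nodal a = C lam + C (e : ℂ) * nodal a := by
    refine mul_right_cancel₀ hgne ?_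
    rw [hfa] at h
    rw [← h]
    have hw := wronskian_nodal a b
    set G := ∏ j, (X - C (a j)) ^ b j
    set N := residueNum a (fun j => (b j : ℤ) - 1)
    rw [hga, Polynomial.derivative_C_mul]
    linear_combination -C g.leadingCoeff * hw
  have hpos : k + l ≠ 0 := by
    intro h0
    rw [hfa, natDegree_nodal, h0] at hdeg
    exact absurd hdeg (lt_irrefl 0)
  have hsum : ∑ j, ((b j : ℤ) - 1) = e := by
    have hc := congrArg (fun p => Polynomial.coeff p (k + l)) hres
    have hlead : (nodal a).coeff (k + l) = 1 := by
      have := (monic_nodal a).coeff_natDegree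
      rwa [natDegree_nodal] at this
    simp only [Polynomial.coeff_add, coeff_residueNum_of_le a _ le_rfl, Polynomial.coeff_C_mul,
      hlead, Polynomial.coeff_C_of_ne_zero hpos, zero_add, mul_one] at hc
    exact_mod_cast hc
  refine ⟨k, l, a, b, hinj, fun j => hroot0 _ (hmem j), hfa, hga, fun j hj => (hk j).2 hj,
    fun j hj => ?_, hsum, ?_⟩
  · have h1 : ¬ 2 ≤ b j := fun h2 => absurd ((hk j).1 h2) (not_lt.2 hj)
    have h2 : b j ≠ 1 := (hfmult _ (hmem j)).2
    lia
  · refine (residueNum_eq_C_iff a _).1 ⟨lam, ?_⟩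
    rw [hsum] at hres
    exact add_right_cancel hres

end

end Virasoro

namespace Virasoro

noncomputable section

open scoped Polynomial
open Polynomial (X C derivative toLaurent)

/-! ### Laurent polynomials and polynomials -/

lemma coeff_toLaurent_natCast (p : ℂ[X]) (n : ℕ) : (toLaurent p).coeff (n : ℤ) = p.coeff n := by
  rw [LaurentPolynomial.coeff_toLaurent]
  exact Finsupp.mapDomain_apply Nat.castEmbedding.injective _ _

lemma coeff_T_mul (m : ℤ) (f : ℂ[T;T⁻¹]) (n : ℤ) : (T m * f).coeff n = f.coeff (n - m) := by
  rw [T, AddMonoidAlgebra.coeff_single_mul_apply, one_mul, neg_add_eq_sub]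

lemma T_neg_mul_T (m : ℤ) : (T (-m) : ℂ[T;T⁻¹]) * T m = 1 := by
  rw [← LaurentPolynomial.T_add, neg_add_cancel, LaurentPolynomial.T_zero]

lemma exists_toLaurent_eq {f : ℂ[T;T⁻¹]} (hf : ∀ n < 0, f.coeff n = 0) :
    ∃ p : ℂ[X], toLaurent p = f := by
  obtain ⟨n, p, hp⟩ := LaurentPolynomial.exists_T_pow f
  rw [← LaurentPolynomial.T_mul] at hp
  have hdvd : X ^ n ∣ p := by
    rw [Polynomial.X_pow_dvd_iff]
    intro d hd
    rw [← coeff_toLaurent_natCast, hp, coeff_T_mul]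
    exact hf _ (by lia)
  obtain ⟨q, rfl⟩ := hdvd
  refine ⟨q, ?_⟩
  rw [map_mul, Polynomial.toLaurent_X_pow] at hp
  exact (LaurentPolynomial.isUnit_T (n : ℤ)).mul_left_cancel hp

lemma del_toLaurent (p : ℂ[X]) : del (toLaurent p) = T 1 * toLaurent (derivative p) := by
  induction p using Polynomial.induction_on' with
  | add p q hp hq => simp only [map_add, hp, hq, mul_add]
  | monomial n a =>
    rw [Polynomial.derivative_monomial, ← Polynomial.C_mul_X_pow_eq_monomial,
      ← Polynomial.C_mul_X_pow_eq_monomial, Polynomial.toLaurent_C_mul_X_pow,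
      Polynomial.toLaurent_C_mul_X_pow, ← LaurentPolynomial.smul_eq_C_mul, Derivation.map_smul,
      del_T, smul_smul, ← LaurentPolynomial.smul_eq_C_mul, mul_smul_comm,
      ← LaurentPolynomial.T_add, Int.cast_natCast]
    rcases n with _ | n
    · simp
    · simp [add_comm]

/-- The term with `e` comes from `∂ t ^ (-e) = -e t ^ (-e)`. -/
lemma wr_toLaurent (f g : ℂ[X]) (e : ℤ) : wr (toLaurent f) (T (-e) * toLaurent g) =
    T (-e) * toLaurent (X * (f * derivative g - g * derivative f) - C (e : ℂ) * f * g) := by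
  simp only [wr, Derivation.leibniz, del_toLaurent, del_T, smul_eq_mul, map_sub, map_mul,
    Polynomial.toLaurent_X, Polynomial.toLaurent_C, LaurentPolynomial.smul_eq_C_mul,
    Int.cast_neg, map_neg]
  ring

/-! ### The subalgebras `𝔰(μ)` -/

lemma Param.P_eq (μ : Param) : μ.P = toLaurent (nodal μ.a) := by
  simp [Param.P, nodal, map_prod, map_sub]

/-- The roots with `r j = -1` have exponent 0, so the product may run over all `j`. -/
lemma Param.Q_eq (μ : Param) :
    μ.Q = T (-∑ j, μ.r j) * toLaurent (∏ j, (X - C (μ.a j)) ^ (μ.r j + 1).toNat) := by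
  rw [Param.Q, map_prod, Finset.prod_filter]
  congr 1
  refine Finset.prod_congr rfl fun j _ => ?_
  split_ifs with hj
  · simp
  · rw [μ.r_mem.2.1 j (not_lt.1 hj)]
    simp

lemma Param.sum_r_pos (μ : Param) : 0 < ∑ j, μ.r j :=
  lt_of_lt_of_le (by exact_mod_cast μ.one_le_k) μ.r_mem.2.2

lemma eval_zero_nodal_ne_zero {n : ℕ} {a : Fin n → ℂ} (ha : ∀ j, a j ≠ 0) :
    (nodal a).eval 0 ≠ 0 := by
  rw [nodal, Polynomial.eval_prod, Finset.prod_ne_zero_iff]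
  simpa using ha

lemma Param.exists_wr_eq (μ : Param) : ∃ lam : ℂ, lam ≠ 0 ∧ wr μ.P μ.Q = lam • μ.Q := by
  obtain ⟨lam, hlam⟩ := (residueNum_eq_C_iff μ.a μ.r).2 μ.a_mem.1
  refine ⟨lam, fun h0 => ?_, ?_⟩
  · have h := congrArg (Polynomial.eval 0) (residueNum_add μ.a μ.r)
    rw [hlam, h0] at h
    simp only [map_zero, zero_add, Polynomial.eval_mul, Polynomial.eval_C, Polynomial.eval_X,
      zero_mul, mul_eq_zero, Int.cast_eq_zero] at h
    exact h.elim μ.sum_r_pos.ne' (eval_zero_nodal_ne_zero μ.a_mem.2)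
  · have hb : ∀ j, (((μ.r j + 1).toNat : ℕ) : ℤ) - 1 = μ.r j := fun j => by
      have : -1 ≤ μ.r j := by
        rcases lt_or_ge j.val μ.k with h | h
        · have := μ.r_mem.1 j h
          lia
        · exact (μ.r_mem.2.1 j h).ge
      lia
    have hw := wronskian_nodal μ.a fun j => (μ.r j + 1).toNat
    simp only [hb] at hw
    rw [hlam] at hw
    rw [μ.P_eq, μ.Q_eq, wr_toLaurent, hw, LaurentPolynomial.smul_eq_C_mul,
      ← Polynomial.toLaurent_C, mul_left_comm, ← map_mul]
    congr 2
    ring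

/-- `Q` has a pole of order `|r| > 0`, whereas `P` is a polynomial with nonzero constant term. -/
lemma Param.linearIndependent (μ : Param) : LinearIndependent ℂ ![μ.P, μ.Q] := by
  have hP0 : μ.P.coeff 0 ≠ 0 := by
    rw [μ.P_eq, ← Nat.cast_zero, coeff_toLaurent_natCast, Polynomial.coeff_zero_eq_eval_zero]
    exact eval_zero_nodal_ne_zero μ.a_mem.2
  have hPe : μ.P.coeff (-∑ j, μ.r j) = 0 := by
    have h := coeff_T_mul (∑ j, μ.r j) μ.P 0
    rw [zero_sub] at h
    obtain ⟨e, he⟩ := Int.eq_ofNat_of_zero_le μ.sum_r_pos.le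
    have he0 := μ.sum_r_pos
    rw [← h, he, μ.P_eq, ← Polynomial.toLaurent_X_pow, ← map_mul, ← Nat.cast_zero,
      coeff_toLaurent_natCast]
    rw [he] at he0
    simp only [Nat.cast_pos] at he0
    simp [Polynomial.coeff_zero_eq_eval_zero, he0.ne']
  have hQe : μ.Q.coeff (-∑ j, μ.r j) ≠ 0 := by
    rw [μ.Q_eq, coeff_T_mul, sub_self, ← Nat.cast_zero, coeff_toLaurent_natCast,
      Polynomial.coeff_zero_eq_eval_zero, Polynomial.eval_prod, Finset.prod_ne_zero_iff]
    intro j _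
    simpa using fun h => absurd h (μ.a_mem.2 j)
  rw [LinearIndependent.pair_iff]
  intro x y h
  have hy : y = 0 := by
    have := congrArg (fun p => p.coeff (-∑ j, μ.r j)) h
    simpa [hPe, hQe] using this
  have hx := congrArg (fun p => p.coeff 0) h
  exact ⟨by simpa [hy, hP0] using hx, hy⟩

/-! ### The subalgebras of dimension `2` of `𝔡` -/

lemma span_pair_smul_add {M : Type*} [AddCommGroup M] [Module ℂ M] (x y : M) {α γ : ℂ} (β : ℂ)
    (hα : α ≠ 0) (hγ : γ ≠ 0) :
    Submodule.span ℂ {α • x + β • y, γ • y} = Submodule.span ℂ {x, y} := by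
  refine le_antisymm ?_ ?_ <;> rw [Submodule.span_le]
  · rintro z (rfl | rfl)
    · exact Submodule.mem_span_pair.2 ⟨α, β, rfl⟩
    · exact Submodule.mem_span_pair.2 ⟨0, γ, by simp⟩
  · rintro z (rfl | rfl)
    · refine Submodule.mem_span_pair.2 ⟨α⁻¹, -(α⁻¹ * β * γ⁻¹), ?_⟩
      rw [smul_add, smul_smul, smul_smul, smul_smul, inv_mul_cancel₀ hα, one_smul, neg_mul,
        mul_assoc _ γ⁻¹ γ, inv_mul_cancel₀ hγ, mul_one, neg_smul, add_neg_cancel_right]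
    · exact Submodule.mem_span_pair.2 ⟨0, γ⁻¹, by simp [smul_smul, inv_mul_cancel₀ hγ]⟩

/-! ### Pairs with `[f ∂, g ∂] = λ g ∂` -/

section Pair

variable {f g : ℂ[T;T⁻¹]} {lam : ℂ}

lemma wr_sub_smul (c : ℂ) (h : wr f g = lam • g) : wr (f - c • g) g = lam • g := by
  rw [sub_eq_add_neg, ← neg_smul, wr_add_left, wr_smul_left, wr_self, smul_zero, add_zero, h]

/-- Choose `c` to remove from `f` the highest exponent `q` of `g`. The new highest exponent `p`
differs from `q`, so the bracket has highest exponent `p + q`; being `λ g`, it has `q`. Hence `p =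
0`. -/
lemma exists_hasTop_sub_smul (hlam : lam ≠ 0) (h : wr f g = lam • g) (hg : g ≠ 0)
    (hfg : ∀ c : ℂ, f - c • g ≠ 0) : ∃ c : ℂ, HasTop (f - c • g) 0 := by
  obtain ⟨q, hq⟩ := exists_hasTop hg
  set c := f.coeff q / g.coeff q
  obtain ⟨p, hp⟩ := exists_hasTop (hfg c)
  have hpq : p ≠ q := by
    rintro rfl
    apply hp.1
    simp [c, hq.1]
  have h1 := hp.wr hq hpq
  rw [wr_sub_smul c h] at h1
  have h2 : HasTop (lam • g) q := ⟨by simp [hlam, hq.1], fun n hn => by simp [hq.2 n hn]⟩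
  have h3 := h1.unique h2
  obtain rfl : p = 0 := by lia
  exact ⟨c, hp⟩

lemma exists_hasBot_sub_smul (hlam : lam ≠ 0) (h : wr f g = lam • g) (hg : g ≠ 0)
    (hfg : ∀ c : ℂ, f - c • g ≠ 0) : ∃ c : ℂ, HasBot (f - c • g) 0 := by
  have h' : wr (LaurentPolynomial.invert f) (LaurentPolynomial.invert g) =
      (-lam) • LaurentPolynomial.invert g := by
    have := congrArg LaurentPolynomial.invert h
    rw [invert_wr, map_smul] at this
    rw [neg_smul, ← this, neg_neg]
  obtain ⟨c, hc⟩ := exists_hasTop_sub_smul (neg_ne_zero.2 hlam) h' (by simpa using hg) fun c hc =>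
    hfg c (by
      rwa [← map_smul, ← map_sub, EmbeddingLike.map_eq_zero_iff] at hc)
  rw [← map_smul, ← map_sub, hasTop_invert, neg_zero] at hc
  exact ⟨c, hc⟩

/-- Here `g` is an eigenvector of `∂`, whose eigenvalues `n` are distinct. -/
lemma exists_eq_smul_T_of_wr_const {c : ℂ} (hlam : lam ≠ 0) (h : wr (c • T 0) g = lam • g)
    (hg : g ≠ 0) : ∃ m : ℤ, m ≠ 0 ∧ ∃ b : ℂ, b ≠ 0 ∧ g = b • T m := by
  have hco : ∀ n, c * n * g.coeff n = lam * g.coeff n := fun n => by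
    have h' : wr (c • T 0) g = c • del g := by
      rw [wr_smul_left, wr, LaurentPolynomial.T_zero, Derivation.map_one_eq_zero, one_mul, mul_zero,
        sub_zero]
    rw [h'] at h
    have := congrArg (fun p => p.coeff n) h
    simp only [AddMonoidAlgebra.coeff_smul_apply, coeff_del, smul_eq_mul] at this
    rw [mul_assoc, this]
  obtain ⟨m, hm⟩ := exists_hasTop hg
  have hcm : c * m = lam := mul_right_cancel₀ hm.1 (hco m)
  refine ⟨m, ?_, g.coeff m, hm.1, eq_smul_T fun n hn => ?_⟩
  · rintro rfl
    exact hlam (by simpa using hcm.symm)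
  · by_contra h0
    have hcn : c * n = lam := mul_right_cancel₀ h0 (hco n)
    have hc : c ≠ 0 := by
      rintro rfl
      exact hlam (by simpa using hcm.symm)
    exact hn (by exact_mod_cast mul_left_cancel₀ hc (hcn.trans hcm.symm))

lemma span_eq_of_const {c d : ℂ} (hlam : lam ≠ 0) (h : wr f g = lam • g) (hg : g ≠ 0)
    (hd : d ≠ 0) (hc : f - c • g = d • T 0) :
    ∃ m : ℤ, m ≠ 0 ∧ Submodule.span ℂ {f, g} = Submodule.span ℂ {T 0, T m} := by
  have h1 := wr_sub_smul c h
  rw [hc] at h1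
  obtain ⟨m, hm, b, hb, hgb⟩ := exists_eq_smul_T_of_wr_const hlam h1 hg
  refine ⟨m, hm, ?_⟩
  rw [← span_pair_smul_add (T 0) (T m) (c * b) hd hb, mul_smul, ← hgb, ← hc, sub_add_cancel]

/-- A noncommuting pair of vector fields spanning a subalgebra is of the form `𝔰(μ)`, unless a
constant vector field occurs. -/
lemma exists_param_of_hasBot_hasTop {c c' : ℂ} (hlam : lam ≠ 0) (h : wr f g = lam • g)
    (htop : HasTop (f - c • g) 0) (hbot : HasBot (f - c' • g) 0)
    (hneg : ∃ n < 0, (f - c • g).coeff n ≠ 0) (hpos : ∃ n > 0, (f - c' • g).coeff n ≠ 0) :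
    ∃ μ : Param, Submodule.span ℂ {f, g} = Submodule.span ℂ {μ.P, μ.Q} := by
  classical
  obtain ⟨m, hm, hFm⟩ := hneg
  -- Only one of `f - c g` and `f - c' g` has a term in `t ^ m`, so `g` has one; thus `g` has a
  -- pole, of order `e > 0`.
  have hgm : g.coeff m ≠ 0 := fun h0 => by
    have := hbot.2 m hm
    simp only [AddMonoidAlgebra.coeff_sub, Finsupp.sub_apply, AddMonoidAlgebra.coeff_smul_apply, h0,
      smul_zero, sub_zero] at this hFm
    exact hFm this
  have hg : g ≠ 0 := fun h0 => hgm (by simp [h0])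
  obtain ⟨q, hq⟩ := exists_hasBot hg
  have hqm : q ≤ m := not_lt.1 fun hlt => hgm (hq.2 m hlt)
  obtain ⟨e, he⟩ := Int.eq_ofNat_of_zero_le (a := -q) (by lia)
  obtain ⟨p₀, hp₀⟩ := exists_toLaurent_eq hbot.2
  obtain ⟨q₀, hq₀⟩ := exists_toLaurent_eq (f := T e * g) fun n hn => by
    rw [coeff_T_mul]
    exact hq.2 _ (by lia)
  have hgq : g = T (-(e : ℤ)) * toLaurent q₀ := by
    rw [hq₀, ← mul_assoc, T_neg_mul_T, one_mul]
  have hp00 : p₀.coeff 0 ≠ 0 := by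
    rw [← coeff_toLaurent_natCast, hp₀]
    exact hbot.1
  have hq00 : q₀.coeff 0 ≠ 0 := by
    rw [← coeff_toLaurent_natCast, hq₀, coeff_T_mul]
    simpa [← he] using hq.1
  have hp0 : p₀ ≠ 0 := fun h0 => hp00 (by simp [h0])
  have hq0 : q₀ ≠ 0 := fun h0 => hq00 (by simp [h0])
  set u := p₀.leadingCoeff with hu
  have hu0 : u ≠ 0 := Polynomial.leadingCoeff_ne_zero.2 hp0
  set p := C u⁻¹ * p₀ with hp
  have hpm : p.Monic := by
    rw [hp, mul_comm]
    exact Polynomial.monic_mul_leadingCoeff_inv hp0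
  have hpdeg : 0 < p.natDegree := by
    rw [hp, Polynomial.natDegree_C_mul (inv_ne_zero hu0)]
    obtain ⟨n, hn, hGn⟩ := hpos
    obtain ⟨n, rfl⟩ := Int.eq_ofNat_of_zero_le hn.lt.le
    rw [← hp₀, coeff_toLaurent_natCast] at hGn
    exact lt_of_lt_of_le (by exact_mod_cast hn) (Polynomial.le_natDegree_of_ne_zero hGn)
  have hpL : toLaurent p = u⁻¹ • (f - c' • g) := by
    rw [hp, map_mul, Polynomial.toLaurent_C, hp₀, ← LaurentPolynomial.smul_eq_C_mul]
  have hode : X * (p * derivative q₀ - q₀ * derivative p) =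
      (C (u⁻¹ * lam) + C (e : ℂ) * p) * q₀ := by
    have h1 := wr_sub_smul c' h
    have h2 : wr (toLaurent p) g = (u⁻¹ * lam) • g := by
      rw [hpL, wr_smul_left, h1, smul_smul]
    rw [hgq, wr_toLaurent, LaurentPolynomial.smul_eq_C_mul, ← Polynomial.toLaurent_C,
      mul_left_comm (toLaurent _) (T _), ← map_mul] at h2
    have h3 := Polynomial.toLaurent_injective
      ((LaurentPolynomial.isUnit_T (-(e : ℤ))).mul_left_cancel h2)
    rw [Int.cast_natCast] at h3
    linear_combination h3
  obtain ⟨k, l, a, b, hinj, ha0, hpa, hqa, hb2, hb0, hsum, hpow⟩ :=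
    exists_of_wronskian (mul_ne_zero (inv_ne_zero hu0) hlam) hode hpm hpdeg
      (by simpa [hp, hu0] using hp00) hq00
  -- This is the condition `|r| ≥ k`. The polynomial `s = t ^ e (f - c g)` is nonzero of degree at
  -- most `e`, and it vanishes at the `k` distinct common roots of `p₀` and `q₀`.
  have hke : k ≤ e := by
    set s := X ^ e * p₀ - C (c - c') * q₀ with hs
    have hsL : toLaurent s = T e * (f - c • g) := by
      rw [hs, map_sub, map_mul, map_mul, Polynomial.toLaurent_X_pow, hp₀, hq₀,
        Polynomial.toLaurent_C, LaurentPolynomial.smul_eq_C_mul, LaurentPolynomial.smul_eq_C_mul,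
        map_sub]
      ring
    have hse : s.coeff e ≠ 0 := by
      rw [← coeff_toLaurent_natCast, hsL, coeff_T_mul, sub_self]
      exact htop.1
    have hs0 : s ≠ 0 := fun h0 => hse (by simp [h0])
    have hsdeg : s.natDegree ≤ e := by
      rw [Polynomial.natDegree_le_iff_coeff_eq_zero]
      intro N hN
      rw [← coeff_toLaurent_natCast, hsL, coeff_T_mul]
      exact htop.2 _ (by lia)
    have hroots : ((Finset.univ.filter fun j : Fin (k + l) => j.val < k).image a).val ⊆ s.roots := by
      intro x hx
      rw [Finset.mem_val, Finset.mem_image] at hx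
      obtain ⟨j, hj, rfl⟩ := hx
      have hjk := (Finset.mem_filter.1 hj).2
      rw [Polynomial.mem_roots hs0, Polynomial.IsRoot.def, hs]
      have hpj : p₀.eval (a j) = 0 := by
        have : p.eval (a j) = 0 := by
          rw [hpa, nodal_eq_mul a j]
          simp
        simpa [hp, hu0] using this
      have hqj : q₀.eval (a j) = 0 := by
        rw [hqa, ← Finset.mul_prod_erase _ _ (Finset.mem_univ j)]
        have := hb2 j hjk
        simp [show b j ≠ 0 by lia]
      simp [hpj, hqj]
    have hcard := (Polynomial.card_le_degree_of_subset_roots hroots).trans hsdeg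
    rw [Finset.card_image_of_injective _ hinj] at hcard
    have hk : (Finset.univ.filter fun j : Fin (k + l) => j.val < k).card = k := by
      rw [Fin.card_filter_val_lt]
      exact min_eq_right (Nat.le_add_right k l)
    exact hk.symm.le.trans hcard
  -- With `k = 0` every `r j` would be `-1`, contradicting `∑ r_j = e > 0`.
  have hk1 : 1 ≤ k := by
    by_contra hk
    have : ∑ j, ((b j : ℤ) - 1) ≤ 0 := Finset.sum_nonpos fun j _ => by
      rw [hb0 j (by lia)]
      norm_num
    lia
  refine ⟨⟨k + l, k, hk1, Nat.le_add_right k l, fun j => (b j : ℤ) - 1, ⟨fun j hj => ?_,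
    fun j hj => ?_, ?_⟩, a, ⟨hpow, ha0⟩⟩, ?_⟩
  · have := hb2 j hj
    lia
  · simp [hb0 j hj]
  · rw [hsum]
    exact_mod_cast hke
  · rw [Param.P_eq, Param.Q_eq]
    simp only [sub_add_cancel, Int.toNat_natCast, hsum]
    rw [← hpa, hpL]
    have hgQ : g = q₀.leadingCoeff •
        (T (-(e : ℤ)) * toLaurent (∏ j, (X - C (a j)) ^ b j)) := by
      rw [LaurentPolynomial.smul_eq_C_mul, ← Polynomial.toLaurent_C, mul_left_comm, ← map_mul,
        ← hqa, ← hgq]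
    have hlc : q₀.leadingCoeff ≠ 0 := Polynomial.leadingCoeff_ne_zero.2 hq0
    set Q := T (-(e : ℤ)) * toLaurent (∏ j, (X - C (a j)) ^ b j)
    have hQg : Q = q₀.leadingCoeff⁻¹ • g := by
      rw [hgQ, smul_smul, inv_mul_cancel₀ hlc, one_smul]
    rw [hQg, smul_sub, smul_smul, sub_eq_add_neg, ← neg_smul,
      span_pair_smul_add f g _ (inv_ne_zero hu0) (inv_ne_zero hlc)]

/-- The noncommuting pairs of vector fields that span a subalgebra. -/
lemma span_pair_classification (hlam : lam ≠ 0) (h : wr f g = lam • g) (hg : g ≠ 0)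
    (hfg : ∀ c : ℂ, f - c • g ≠ 0) :
    (∃ m : ℤ, m ≠ 0 ∧ Submodule.span ℂ {f, g} = Submodule.span ℂ {T 0, T m}) ∨
      ∃ μ : Param, Submodule.span ℂ {f, g} = Submodule.span ℂ {μ.P, μ.Q} := by
  obtain ⟨c, hc⟩ := exists_hasTop_sub_smul hlam h hg hfg
  obtain ⟨c', hc'⟩ := exists_hasBot_sub_smul hlam h hg hfg
  by_cases hneg : ∃ n < 0, (f - c • g).coeff n ≠ 0
  · by_cases hpos : ∃ n > 0, (f - c' • g).coeff n ≠ 0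
    · exact Or.inr (exists_param_of_hasBot_hasTop hlam h hc hc' hneg hpos)
    · push Not at hpos
      refine Or.inl (span_eq_of_const hlam h hg hc'.1 (eq_smul_T fun n hn => ?_))
      rcases lt_or_gt_of_ne hn with hn | hn
      · exact hc'.2 n hn
      · exact hpos n hn
  · push Not at hneg
    refine Or.inl (span_eq_of_const hlam h hg hc.1 (eq_smul_T fun n hn => ?_))
    rcases lt_or_gt_of_ne hn with hn | hn
    · exact hneg n hn
    · exact hc.2 n hn

/-- After the highest exponents are made distinct, the bracket has a leading term. So no
two-dimensional subalgebra of `𝔡` is abelian. -/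
lemma wr_ne_zero (hg : g ≠ 0) (hfg : ∀ c : ℂ, f - c • g ≠ 0) : wr f g ≠ 0 := by
  intro h
  obtain ⟨q, hq⟩ := exists_hasTop hg
  obtain ⟨p, hp⟩ := exists_hasTop (hfg (f.coeff q / g.coeff q))
  have hpq : p ≠ q := by
    rintro rfl
    apply hp.1
    simp [hq.1]
  have h1 := (hp.wr hq hpq).1
  rw [wr_sub_smul (lam := 0) _ (by rw [h, zero_smul])] at h1
  simp at h1

/-- Replacing `g` by the bracket `a f + b g` itself makes it an eigenvector of `wr f` with
eigenvalue `b`. -/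
lemma span_pair_classification_of_mem {a b : ℂ} (hb : b ≠ 0) (h : wr f g = a • f + b • g)
    (hli : LinearIndependent ℂ ![f, g]) :
    (∃ m : ℤ, m ≠ 0 ∧ Submodule.span ℂ {f, g} = Submodule.span ℂ {T 0, T m}) ∨
      ∃ μ : Param, Submodule.span ℂ {f, g} = Submodule.span ℂ {μ.P, μ.Q} := by
  rw [LinearIndependent.pair_iff] at hli
  have hspan : Submodule.span ℂ {f, g} = Submodule.span ℂ {f, a • f + b • g} := by
    rw [Set.pair_comm, Set.pair_comm f, ← span_pair_smul_add g f a hb one_ne_zero, one_smul,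
      add_comm]
  rw [hspan]
  refine span_pair_classification hb (f := f) (g := a • f + b • g) ?_ (fun h0 => hb (hli a b h0).2)
    fun c h0 => ?_
  · rw [wr_add_right, wr_smul_right, wr_smul_right, wr_self, smul_zero, zero_add, h]
  · have h1 := hli (1 - c * a) (-(c * b)) (by rw [← h0]; module)
    have hc : c = 0 := by simpa [hb] using h1.2
    simpa [hc] using h1.1

end Pair

lemma exists_pair_of_finrank_two {M : Type*} [AddCommGroup M] [Module ℂ M] {V : Submodule ℂ M}
    (h2 : Module.finrank ℂ V = 2) :
    ∃ x y : M, V = Submodule.span ℂ {x, y} ∧ LinearIndependent ℂ ![x, y] := by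
  have : FiniteDimensional ℂ V := Module.finite_of_finrank_eq_succ h2
  set v := Module.finBasisOfFinrankEq ℂ V h2
  have hv : V.subtype ∘ v = ![(v 0 : M), (v 1 : M)] := by
    ext i
    fin_cases i <;> rfl
  refine ⟨v 0, v 1, ?_, ?_⟩
  · have h1 := congrArg (Submodule.map V.subtype) v.span_eq
    rw [Submodule.map_span, Submodule.map_top, Submodule.range_subtype, ← Set.range_comp, hv,
      Matrix.range_cons, Matrix.range_cons, Matrix.range_empty, Set.union_empty] at h1
    exact h1.symm
  · rw [← hv]
    exact v.linearIndependent.map' V.subtype (Submodule.ker_subtype V)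

/-- The subalgebras of dimension `2` of `𝔡`. -/
lemma eq_span_of_finrank_two {V : Submodule ℂ ℂ[T;T⁻¹]} (hV : WrClosed V)
    (h2 : Module.finrank ℂ V = 2) :
    (∃ m : ℤ, m ≠ 0 ∧ V = Submodule.span ℂ {T 0, T m}) ∨
      ∃ μ : Param, V = Submodule.span ℂ {μ.P, μ.Q} := by
  obtain ⟨f, g, rfl, hli⟩ := exists_pair_of_finrank_two h2
  obtain ⟨a, b, hab⟩ := Submodule.mem_span_pair.1 (hV f (Submodule.subset_span (by simp)) g
    (Submodule.subset_span (by simp)))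
  by_cases hb : b = 0
  · have ha : a ≠ 0 := by
      rintro rfl
      refine wr_ne_zero (f := f) (g := g) (hli.ne_zero 1) (fun c h0 => ?_) (by simp [← hab, hb])
      rw [LinearIndependent.pair_iff] at hli
      exact one_ne_zero (hli 1 (-c) (by rw [← h0]; module)).1
    rw [Set.pair_comm]
    exact span_pair_classification_of_mem (a := -b) (b := -a) (neg_ne_zero.2 ha)
      (by rw [wr_skew, ← hab]; module) (LinearIndependent.pair_symm_iff.1 hli)
  · exact span_pair_classification_of_mem hb hab.symm hli

end

end Virasoro

namespace Virasoro

noncomputable section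

/-! ### The projection of the Virasoro algebra onto `𝔡`, in coordinates -/

/-- The vector field `f ∂` as an element of the Virasoro algebra. -/
def vec : ℂ[T;T⁻¹] →ₗ[ℂ] Vir where
  toFun f := incl (f • del)
  map_add' f g := by rw [add_smul, map_add]
  map_smul' c f := by rw [smul_assoc, map_smul, RingHom.id_apply]

/-- The coordinate of the component in `𝔡` of an element of the Virasoro algebra. -/
def vecCoord : Vir →ₗ[ℂ] ℂ[T;T⁻¹] where
  toFun x := coord ((LieAlgebra.ofProd cocycle).symm x).1
  map_add' x y := by simp
  map_smul' c x := by simp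

/-- The coefficient of `K` of an element of the Virasoro algebra. -/
def centralCoeff : Vir →ₗ[ℂ] ℂ where
  toFun x := TrivialLieModule.equiv ℂ Witt ℂ ((LieAlgebra.ofProd cocycle).symm x).2
  map_add' x y := by simp
  map_smul' c x := by simp

lemma vecCoord_vec (f : ℂ[T;T⁻¹]) : vecCoord (vec f) = f := coord_smul_del f

lemma centralCoeff_vec (f : ℂ[T;T⁻¹]) : centralCoeff (vec f) = 0 := by
  change TrivialLieModule.equiv ℂ Witt ℂ 0 = 0
  exact map_zero _

lemma vecCoord_K : vecCoord K = 0 := by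
  change coord 0 = 0
  exact map_zero _

lemma centralCoeff_K : centralCoeff K = 1 := by
  change TrivialLieModule.equiv ℂ Witt ℂ ((TrivialLieModule.equiv ℂ Witt ℂ).symm 1) = 1
  exact LinearEquiv.apply_symm_apply _ _

lemma vec_add_smul_K (x : Vir) : vec (vecCoord x) + centralCoeff x • K = x := by
  apply (LieAlgebra.ofProd cocycle).symm.injective
  rw [LieAlgebra.of_symm_add, LieAlgebra.of_symm_smul]
  refine Prod.ext ?_ ?_
  · change coord _ • del + centralCoeff x • (0 : Witt) = _
    rw [coord_smul, smul_zero, add_zero]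
  · change 0 + centralCoeff x • (TrivialLieModule.equiv ℂ Witt ℂ).symm 1 = _
    rw [zero_add, ← map_smul, smul_eq_mul, mul_one]
    exact LinearEquiv.symm_apply_apply _ _

lemma lie_vec (f g : ℂ[T;T⁻¹]) :
    ⁅vec f, vec g⁆ = vec (wr f g) + form (f • del) (g • del) • K := by
  change ⁅incl (f • del), incl (g • del)⁆ = incl (wr f g • del) + _
  rw [lie_incl, ← coord_smul ⁅f • del, g • del⁆, coord_lie_eq_wr, coord_smul_del, coord_smul_del]

lemma K_lie (x : Vir) : ⁅K, x⁆ = 0 := by rw [← lie_skew, lie_K, neg_zero]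

lemma lie_add_smul_K (x y : Vir) (a b : ℂ) : ⁅x + a • K, y + b • K⁆ = ⁅x, y⁆ := by
  simp only [lie_add, add_lie, lie_smul, smul_lie, lie_K, K_lie, smul_zero, add_zero]

lemma vecCoord_lie (x y : Vir) : vecCoord ⁅x, y⁆ = wr (vecCoord x) (vecCoord y) := by
  conv_lhs => rw [← vec_add_smul_K x, ← vec_add_smul_K y, lie_add_smul_K, lie_vec, map_add,
    map_smul, vecCoord_vec, vecCoord_K, smul_zero, add_zero]

lemma L_eq_vec (m : ℤ) : L m = vec (-T m) := by
  exact congrArg incl (neg_smul (T m : ℂ[T;T⁻¹]) del).symm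

lemma vecCoord_L (m : ℤ) : vecCoord (L m) = -T m := by rw [L_eq_vec, vecCoord_vec]

lemma eq_smul_K_of_vecCoord_eq_zero {x : Vir} (h : vecCoord x = 0) : x = centralCoeff x • K := by
  conv_lhs => rw [← vec_add_smul_K x, h, map_zero, zero_add]

/-! ### Subspaces containing `K` -/

lemma map_vec_sup_span_K (V : Submodule ℂ ℂ[T;T⁻¹]) :
    V.map vec ⊔ Submodule.span ℂ {K} = V.comap vecCoord := by
  refine le_antisymm (sup_le ?_ ?_) fun x hx => ?_
  · rintro _ ⟨f, hf, rfl⟩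
    rwa [Submodule.mem_comap, vecCoord_vec]
  · rw [Submodule.span_singleton_le_iff_mem, Submodule.mem_comap, vecCoord_K]
    exact V.zero_mem
  · rw [← vec_add_smul_K x]
    exact Submodule.add_mem_sup (Submodule.mem_map_of_mem hx)
      (Submodule.smul_mem _ _ (Submodule.mem_span_singleton_self _))

/-- The preimage of `V` in the Virasoro algebra is isomorphic to `V × ℂ`. -/
def comapVecCoordEquiv (V : Submodule ℂ ℂ[T;T⁻¹]) : V.comap vecCoord ≃ₗ[ℂ] V × ℂ where
  toFun x := (⟨vecCoord x, x.2⟩, centralCoeff x)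
  map_add' x y := by ext <;> simp
  map_smul' c x := by ext <;> simp
  invFun p := ⟨vec p.1 + p.2 • K, by
    simp [Submodule.mem_comap, vecCoord_vec, vecCoord_K]⟩
  left_inv x := Subtype.ext (vec_add_smul_K x)
  right_inv p := by
    refine Prod.ext (Subtype.ext ?_) ?_
    · simp [vecCoord_vec, vecCoord_K]
    · simp [centralCoeff_vec, centralCoeff_K]

lemma finrank_comap_vecCoord (V : Submodule ℂ ℂ[T;T⁻¹]) [FiniteDimensional ℂ V] :
    Module.finrank ℂ (V.comap vecCoord) = Module.finrank ℂ V + 1 := by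
  rw [(comapVecCoordEquiv V).finrank_eq, Module.finrank_prod, Module.finrank_self]

/-- The kernel of the projection is `ℂ K`, which lies in `W`. -/
lemma eq_comap_map_vecCoord {W : Submodule ℂ Vir} (hK : K ∈ W) :
    W = (W.map vecCoord).comap vecCoord := by
  refine le_antisymm (Submodule.le_comap_map _ _) ?_
  rintro x ⟨w, hw, hwx⟩
  have h : vecCoord (x - w) = 0 := by rw [map_sub, hwx, sub_self]
  have h' := eq_smul_K_of_vecCoord_eq_zero h
  rw [← sub_add_cancel x w, h']
  exact W.add_mem (W.smul_mem _ hK) hw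

lemma finrank_map_vecCoord_of_notMem {W : Submodule ℂ Vir} (hK : K ∉ W) :
    Module.finrank ℂ (W.map vecCoord) = Module.finrank ℂ W := by
  have hinj : Function.Injective (vecCoord.domRestrict W) := by
    rw [injective_iff_map_eq_zero]
    intro x hx
    have h := eq_smul_K_of_vecCoord_eq_zero (x := x) hx
    by_cases h0 : centralCoeff (x : Vir) = 0
    · rw [h0, zero_smul] at h
      exact Subtype.ext h
    · exact absurd ((W.smul_mem_iff h0).1 (h ▸ x.2)) hK
  rw [← LinearMap.range_domRestrict, LinearMap.finrank_range_of_inj hinj]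

lemma exists_add_smul_K_mem {W : Submodule ℂ Vir} {f : ℂ[T;T⁻¹]} (hf : f ∈ W.map vecCoord) :
    ∃ c : ℂ, vec f + c • K ∈ W := by
  obtain ⟨w, hw, rfl⟩ := hf
  exact ⟨centralCoeff w, by rwa [vec_add_smul_K]⟩

/-! ### Subspaces closed under the bracket -/

/-- The subspace `W` of the Virasoro algebra is closed under the bracket. -/
def LieClosed (W : Submodule ℂ Vir) : Prop := ∀ x ∈ W, ∀ y ∈ W, ⁅x, y⁆ ∈ W

lemma isSubalgebraOfDim_iff {d : ℕ} {W : Submodule ℂ Vir} :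
    IsSubalgebraOfDim d W ↔ LieClosed W ∧ Module.finrank ℂ W = d := by
  refine and_congr_left fun _ => ⟨?_, fun h => ?_⟩
  · rintro ⟨b, rfl⟩ x hx y hy
    exact b.lie_mem hx hy
  · exact ⟨{ W with lie_mem' := fun {x y} hx hy => h x hx y hy }, rfl⟩

lemma LieClosed.map_vecCoord {W : Submodule ℂ Vir} (hW : LieClosed W) :
    WrClosed (W.map vecCoord) := by
  rintro _ ⟨x, hx, rfl⟩ _ ⟨y, hy, rfl⟩
  exact ⟨⁅x, y⁆, hW x hx y hy, vecCoord_lie x y⟩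

lemma WrClosed.comap_vecCoord {V : Submodule ℂ ℂ[T;T⁻¹]} (hV : WrClosed V) :
    LieClosed (V.comap vecCoord) := fun x hx y hy => by
  rw [Submodule.mem_comap, vecCoord_lie]
  exact hV _ hx _ hy

lemma map₂_mem_span {M : Type*} [AddCommGroup M] [Module ℂ M] (B : M →ₗ[ℂ] M →ₗ[ℂ] M) {s : Set M}
    (h : ∀ x ∈ s, ∀ y ∈ s, B x y ∈ Submodule.span ℂ s) :
    ∀ x ∈ Submodule.span ℂ s, ∀ y ∈ Submodule.span ℂ s, B x y ∈ Submodule.span ℂ s := by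
  have : Submodule.map₂ B (Submodule.span ℂ s) (Submodule.span ℂ s) ≤ Submodule.span ℂ s := by
    rw [Submodule.map₂_span_span, Submodule.span_le]
    rintro _ ⟨x, hx, y, hy, rfl⟩
    exact h x hx y hy
  exact Submodule.map₂_le.1 this

lemma lieClosed_span {s : Set Vir} (h : ∀ x ∈ s, ∀ y ∈ s, ⁅x, y⁆ ∈ Submodule.span ℂ s) :
    LieClosed (Submodule.span ℂ s) :=
  map₂_mem_span (LinearMap.mk₂ ℂ (fun x y : Vir => ⁅x, y⁆) add_lie smul_lie lie_add
    fun c x y => lie_smul c x y) h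

lemma lieClosed_span_pair {x y : Vir} (h : ⁅x, y⁆ ∈ Submodule.span ℂ {x, y}) :
    LieClosed (Submodule.span ℂ {x, y}) := by
  refine lieClosed_span ?_
  rintro a (rfl | rfl) b (rfl | rfl)
  · simp
  · exact h
  · rw [← lie_skew]
    exact Submodule.neg_mem _ h
  · simp

lemma wrClosed_span {s : Set ℂ[T;T⁻¹]} (h : ∀ x ∈ s, ∀ y ∈ s, wr x y ∈ Submodule.span ℂ s) :
    WrClosed (Submodule.span ℂ s) :=
  map₂_mem_span (LinearMap.mk₂ ℂ wr wr_add_left wr_smul_left wr_add_right wr_smul_right) h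

lemma wrClosed_span_pair {x y : ℂ[T;T⁻¹]} (h : wr x y ∈ Submodule.span ℂ {x, y}) :
    WrClosed (Submodule.span ℂ {x, y}) := by
  refine wrClosed_span ?_
  rintro a (rfl | rfl) b (rfl | rfl)
  · simp [wr_self]
  · exact h
  · rw [wr_skew]
    exact Submodule.neg_mem _ h
  · simp [wr_self]

/-! ### The subalgebras that occur -/

lemma linearIndependent_T {ι : Type*} {v : ι → ℤ} (hv : Function.Injective v) :
    LinearIndependent ℂ fun i => (T (v i) : ℂ[T;T⁻¹]) :=
  (AddMonoidAlgebra.basis ℤ ℂ).linearIndependent.comp v hv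

lemma linearIndependent_T_pair {m : ℤ} (hm : m ≠ 0) :
    LinearIndependent ℂ ![(T 0 : ℂ[T;T⁻¹]), T m] := by
  have hv : Function.Injective ![0, m] := by
    intro i j h
    fin_cases i <;> fin_cases j <;> simp at h ⊢ <;> lia
  convert linearIndependent_T hv using 1
  ext i : 1
  fin_cases i <;> rfl

lemma linearIndependent_T_triple {m : ℤ} (hm : m ≠ 0) :
    LinearIndependent ℂ ![(T 0 : ℂ[T;T⁻¹]), T (-m), T m] := by
  have hv : Function.Injective ![0, -m, m] := by
    intro i j h
    fin_cases i <;> fin_cases j <;> simp at h ⊢ <;> lia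
  convert linearIndependent_T hv using 1
  ext i : 1
  fin_cases i <;> rfl

lemma finrank_span_pair {M : Type*} [AddCommGroup M] [Module ℂ M] {x y : M}
    (h : LinearIndependent ℂ ![x, y]) : Module.finrank ℂ (Submodule.span ℂ {x, y}) = 2 := by
  have := finrank_span_eq_card h
  rwa [Matrix.range_cons, Matrix.range_cons, Matrix.range_empty, Set.union_empty] at this

lemma finrank_span_triple {M : Type*} [AddCommGroup M] [Module ℂ M] {x y z : M}
    (h : LinearIndependent ℂ ![x, y, z]) :
    Module.finrank ℂ (Submodule.span ℂ {x, y, z}) = 3 := by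
  have := finrank_span_eq_card h
  rwa [Matrix.range_cons, Matrix.range_cons, Matrix.range_cons, Matrix.range_empty,
    Set.union_empty] at this

lemma finrank_span_pair_of_vecCoord {x y : Vir} {f g : ℂ[T;T⁻¹]}
    (h : LinearIndependent ℂ ![f, g]) (hx : vecCoord x = f) (hy : vecCoord y = g) :
    Module.finrank ℂ (Submodule.span ℂ {x, y}) = 2 := by
  refine finrank_span_pair (LinearIndependent.of_comp vecCoord ?_)
  convert h using 1
  ext i : 1
  fin_cases i
  · exact hx
  · exact hy

lemma finrank_span_triple_of_vecCoord {x y z : Vir} {f g h : ℂ[T;T⁻¹]}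
    (hli : LinearIndependent ℂ ![f, g, h]) (hx : vecCoord x = f) (hy : vecCoord y = g)
    (hz : vecCoord z = h) : Module.finrank ℂ (Submodule.span ℂ {x, y, z}) = 3 := by
  refine finrank_span_triple (LinearIndependent.of_comp vecCoord ?_)
  convert hli using 1
  ext i : 1
  fin_cases i
  · exact hx
  · exact hy
  · exact hz

lemma map_vec_span_pair (f g : ℂ[T;T⁻¹]) :
    (Submodule.span ℂ {f, g}).map vec =
      (Submodule.span ℂ {f • del, g • del}).map incl := by
  rw [Submodule.map_span, Submodule.map_span, Set.image_pair, Set.image_pair]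
  rfl

lemma map_z_eq (m : ℤ) : (z m).map incl = (Submodule.span ℂ {T 0, T m}).map vec := by
  rw [map_vec_span_pair, z, LaurentPolynomial.T_zero, one_smul]

lemma map_s_eq (μ : Param) : (s μ).map incl = (Submodule.span ℂ {μ.P, μ.Q}).map vec := by
  rw [map_vec_span_pair, s]

lemma wrClosed_T_pair (m : ℤ) : WrClosed (Submodule.span ℂ {T 0, T m}) := by
  refine wrClosed_span_pair ?_
  rw [wr_T, zero_add]
  exact Submodule.smul_mem _ _ (Submodule.subset_span (by simp))

lemma wrClosed_T_triple (m : ℤ) : WrClosed (Submodule.span ℂ {T 0, T (-m), T m}) := by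
  refine wrClosed_span ?_
  rintro _ (rfl | rfl | rfl) _ (rfl | rfl | rfl) <;> rw [wr_T]
  all_goals first
    | rw [sub_self, zero_smul]; exact Submodule.zero_mem _
    | refine Submodule.smul_mem _ _ (Submodule.subset_span ?_); simp

lemma Param.wrClosed (μ : Param) : WrClosed (Submodule.span ℂ {μ.P, μ.Q}) := by
  obtain ⟨lam, -, h⟩ := μ.exists_wr_eq
  refine wrClosed_span_pair ?_
  rw [h]
  exact Submodule.smul_mem _ _ (Submodule.subset_span (by simp))

lemma span_L_K (m : ℤ) : Submodule.span ℂ {L 0, L (-m), L m, K} =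
    (Submodule.span ℂ {T 0, T (-m), T m}).comap vecCoord := by
  have h : ({L 0, L (-m), L m, K} : Set Vir) = vec '' (-{T 0, T (-m), T m}) ∪ {K} := by
    simp only [L_eq_vec, ← Set.image_neg_eq_neg, Set.image_insert_eq, Set.image_singleton,
      Set.insert_union, Set.singleton_union]
  rw [h, Submodule.span_union, ← Submodule.map_span, Submodule.span_neg, map_vec_sup_span_K]

end

end Virasoro

namespace Virasoro

noncomputable section

/-! ### Classification by dimension -/

lemma finrank_map_vecCoord {W : Submodule ℂ Vir} [FiniteDimensional ℂ W] (hK : K ∈ W) :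
    Module.finrank ℂ W = Module.finrank ℂ (W.map vecCoord) + 1 := by
  conv_lhs => rw [eq_comap_map_vecCoord hK]
  exact finrank_comap_vecCoord _

lemma finrank_comap_of_finrank {V : Submodule ℂ ℂ[T;T⁻¹]} {d : ℕ}
    (h : Module.finrank ℂ V = d + 1) : Module.finrank ℂ (V.comap vecCoord) = d + 2 := by
  have : FiniteDimensional ℂ V := Module.finite_of_finrank_eq_succ h
  rw [finrank_comap_vecCoord, h]

lemma finrank_le_four {W : Submodule ℂ Vir} [FiniteDimensional ℂ W] (hW : LieClosed W) :
    Module.finrank ℂ W ≤ 4 := by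
  have h3 := finrank_le_three hW.map_vecCoord
  by_cases hK : K ∈ W
  · rw [finrank_map_vecCoord hK]
    lia
  · rw [← finrank_map_vecCoord_of_notMem hK]
    lia

lemma exists_span_singleton_of_finrank_one {M : Type*} [AddCommGroup M] [Module ℂ M]
    {V : Submodule ℂ M} (h : Module.finrank ℂ V = 1) :
    ∃ x : M, x ≠ 0 ∧ V = Submodule.span ℂ {x} := by
  obtain ⟨v, hv, hspan⟩ := finrank_eq_one_iff'.1 h
  refine ⟨v, fun h0 => hv (Subtype.ext h0), le_antisymm (fun w hw => ?_) ?_⟩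
  · obtain ⟨c, hc⟩ := hspan ⟨w, hw⟩
    exact Submodule.mem_span_singleton.2 ⟨c, congrArg Subtype.val hc⟩
  · rw [Submodule.span_singleton_le_iff_mem]
    exact v.2

lemma isSubalgebraOfDim_one_iff (W : Submodule ℂ Vir) :
    IsSubalgebraOfDim 1 W ↔ ∃ X : Vir, X ≠ 0 ∧ W = Submodule.span ℂ {X} := by
  rw [isSubalgebraOfDim_iff]
  constructor
  · rintro ⟨-, h⟩
    exact exists_span_singleton_of_finrank_one h
  · rintro ⟨X, hX, rfl⟩
    refine ⟨lieClosed_span ?_, finrank_span_singleton hX⟩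
    rintro _ rfl _ rfl
    simp

lemma Param.lie_vec_P_Q (μ : Param) : ∃ lam c : ℂ, lam ≠ 0 ∧
    ⁅vec μ.P, vec μ.Q⁆ = lam • vec μ.Q + c • K := by
  obtain ⟨lam, hlam, h⟩ := μ.exists_wr_eq
  exact ⟨lam, _, hlam, by rw [lie_vec, h, map_smul]⟩

lemma Param.Q_ne_zero (μ : Param) : μ.Q ≠ 0 := μ.linearIndependent.ne_zero 1

lemma smul_vec_add_smul_K_inj {f : ℂ[T;T⁻¹]} (hf : f ≠ 0) {a b c d : ℂ}
    (h : a • vec f + b • K = c • vec f + d • K) : a = c ∧ b = d := by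
  have h1 := congrArg vecCoord h
  have h2 := congrArg centralCoeff h
  simp only [map_add, map_smul, vecCoord_vec, vecCoord_K, smul_zero, add_zero, centralCoeff_vec,
    centralCoeff_K, mul_zero, zero_add, smul_eq_mul, mul_one] at h1 h2
  exact ⟨smul_left_injective ℂ hf h1, h2⟩

lemma Param.existsUnique_lie (μ : Param) : ∃! p : ℂ × ℂ,
    ⁅vec μ.P, vec μ.Q⁆ = p.1 • vec μ.Q + (p.1 * p.2) • K := by
  obtain ⟨lam, c, hlam, h⟩ := μ.lie_vec_P_Q
  -- Since `λ ≠ 0`, the central coefficient `c` can be written as `λ β₀`.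
  refine ⟨(lam, c / lam), ?_, ?_⟩
  · simp only [h, mul_div_cancel₀ c hlam]
  · rintro ⟨a, b⟩ hab
    simp only at hab
    rw [h] at hab
    obtain ⟨rfl, rfl⟩ := smul_vec_add_smul_K_inj μ.Q_ne_zero hab
    rw [mul_div_cancel_left₀ b hlam]

lemma Param.ne_zero_of_lie_eq (μ : Param) {a b : ℂ}
    (hab : ⁅vec μ.P, vec μ.Q⁆ = a • vec μ.Q + (a * b) • K) : a ≠ 0 := by
  obtain ⟨lam, c, hlam, h⟩ := μ.lie_vec_P_Q
  rw [h] at hab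
  exact (smul_vec_add_smul_K_inj μ.Q_ne_zero hab).1 ▸ hlam

/-- The bracket with `L 0 + a • K` yields `-m L_m` with no central term, whatever `a` and `b` are.
-/
lemma L_mem_of_add_smul_K_mem {W : Submodule ℂ Vir} (hW : LieClosed W) {m : ℤ} (hm : m ≠ 0)
    {a b : ℂ} (h0 : L 0 + a • K ∈ W) (h : L m + b • K ∈ W) : L m ∈ W := by
  have h1 := hW _ h0 _ h
  rw [lie_add_smul_K, lie_L, if_neg (by lia), zero_smul, add_zero, zero_add] at h1
  refine (W.smul_mem_iff ?_).1 h1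
  simpa using hm

lemma exists_L_add_smul_K_mem {W : Submodule ℂ Vir} {m : ℤ}
    (h : (T m : ℂ[T;T⁻¹]) ∈ W.map vecCoord) : ∃ c : ℂ, L m + c • K ∈ W := by
  rw [L_eq_vec]
  exact exists_add_smul_K_mem (Submodule.neg_mem _ h)

lemma neg_pair {f g : ℂ[T;T⁻¹]} (h : LinearIndependent ℂ ![f, g]) :
    LinearIndependent ℂ ![-f, -g] := by
  simpa using h

lemma finrank_span_L_pair (α : ℂ) {m : ℤ} (hm : m ≠ 0) :
    Module.finrank ℂ (Submodule.span ℂ {L 0 + α • K, L m}) = 2 :=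
  finrank_span_pair_of_vecCoord (neg_pair (linearIndependent_T_pair hm))
    (by rw [map_add, map_smul, vecCoord_K, smul_zero, add_zero, vecCoord_L]) (vecCoord_L m)

lemma finrank_span_P_Q (μ : Param) (α β : ℂ) :
    Module.finrank ℂ (Submodule.span ℂ {vec μ.P + α • K, vec μ.Q + β • K}) = 2 :=
  finrank_span_pair_of_vecCoord μ.linearIndependent
    (by rw [map_add, map_smul, vecCoord_K, smul_zero, add_zero, vecCoord_vec])
    (by rw [map_add, map_smul, vecCoord_K, smul_zero, add_zero, vecCoord_vec])

lemma isSubalgebraOfDim_two_iff (W : Submodule ℂ Vir) : IsSubalgebraOfDim 2 W ↔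
    (∃ X : Witt, X ≠ 0 ∧ W = Submodule.span ℂ {incl X} ⊔ Submodule.span ℂ {K}) ∨
    (∃ (α : ℂ) (m : ℤ), m ≠ 0 ∧ W = Submodule.span ℂ {L 0 + α • K, L m}) ∨
    (∃ (μ : Param) (α lam β₀ : ℂ),
      ⁅vec μ.P, vec μ.Q⁆ = lam • vec μ.Q + (lam * β₀) • K ∧
      W = Submodule.span ℂ {vec μ.P + α • K, vec μ.Q + β₀ • K}) := by
  rw [isSubalgebraOfDim_iff]
  constructor
  · rintro ⟨hW, h2⟩
    have : FiniteDimensional ℂ W := Module.finite_of_finrank_eq_succ h2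
    by_cases hK : K ∈ W
    · left
      have h1 : Module.finrank ℂ (W.map vecCoord) = 1 := by
        have := finrank_map_vecCoord hK
        lia
      obtain ⟨f, hf, hV⟩ := exists_span_singleton_of_finrank_one h1
      refine ⟨f • del, fun h0 => hf ?_, ?_⟩
      · have := congrArg coord h0
        rwa [coord_smul_del, map_zero] at this
      · rw [eq_comap_map_vecCoord hK, hV, ← map_vec_sup_span_K, Submodule.map_span,
          Set.image_singleton]
        rfl
    · right
      have hV2 : Module.finrank ℂ (W.map vecCoord) = 2 := by
        rw [finrank_map_vecCoord_of_notMem hK, h2]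
      rcases eq_span_of_finrank_two hW.map_vecCoord hV2 with ⟨m, hm, hV⟩ | ⟨μ, hV⟩
      · left
        obtain ⟨α, hα⟩ := exists_L_add_smul_K_mem (W := W) (m := 0)
          (hV ▸ Submodule.subset_span (by simp))
        obtain ⟨β, hβ⟩ := exists_L_add_smul_K_mem (W := W) (m := m)
          (hV ▸ Submodule.subset_span (by simp))
        refine ⟨α, m, hm, (Submodule.eq_of_le_of_finrank_eq ?_ ?_).symm⟩
        · rw [Submodule.span_le]
          rintro x (rfl | rfl)
          exacts [hα, L_mem_of_add_smul_K_mem hW hm hα hβ]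
        · rw [finrank_span_L_pair α hm, h2]
      · right
        obtain ⟨α, hα⟩ := exists_add_smul_K_mem (W := W) (f := μ.P)
          (hV ▸ Submodule.subset_span (by simp))
        obtain ⟨β, hβ⟩ := exists_add_smul_K_mem (W := W) (f := μ.Q)
          (hV ▸ Submodule.subset_span (by simp))
        obtain ⟨⟨lam, β₀⟩, h, -⟩ := μ.existsUnique_lie
        refine ⟨μ, α, lam, β₀, h, (Submodule.eq_of_le_of_finrank_eq ?_ ?_).symm⟩
        -- The bracket is `λ (Q + β₀ K)`, independently of `α` and `β`.
        · have h1 := hW _ hα _ hβ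
          rw [lie_add_smul_K, h, mul_smul, ← smul_add,
            W.smul_mem_iff (μ.ne_zero_of_lie_eq h)] at h1
          rw [Submodule.span_le]
          rintro x (rfl | rfl)
          exacts [hα, h1]
        · rw [finrank_span_P_Q, h2]
  · rintro (⟨X, hX, rfl⟩ | ⟨α, m, hm, rfl⟩ | ⟨μ, α, lam, β₀, h, rfl⟩)
    · have hX' : coord X ≠ 0 := fun h0 => hX (by rw [← coord_smul X, h0, zero_smul])
      have hs : Submodule.span ℂ {incl X} ⊔ Submodule.span ℂ {K} =
          (Submodule.span ℂ {coord X}).comap vecCoord := by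
        rw [← map_vec_sup_span_K, Submodule.map_span, Set.image_singleton]
        change _ = Submodule.span ℂ {incl (coord X • del)} ⊔ _
        rw [coord_smul]
      rw [hs, finrank_comap_vecCoord, finrank_span_singleton hX']
      refine ⟨(wrClosed_span ?_).comap_vecCoord, rfl⟩
      rintro _ rfl _ rfl
      simp [wr_self]
    · refine ⟨lieClosed_span_pair ?_, finrank_span_L_pair α hm⟩
      have := lie_add_smul_K (L 0) (L m) α 0
      rw [zero_smul, add_zero] at this
      rw [this, lie_L, if_neg (by lia), zero_smul, add_zero, zero_add]
      exact Submodule.smul_mem _ _ (Submodule.subset_span (by simp))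
    · refine ⟨lieClosed_span_pair ?_, finrank_span_P_Q μ α β₀⟩
      rw [lie_add_smul_K, h, mul_smul, ← smul_add]
      exact Submodule.smul_mem _ _ (Submodule.subset_span (by simp))

/-- The constant in dimension 3 is `(m ^ 3 - m) / 12` divided by `2 m`. -/
lemma lie_L_neg (m : ℤ) : ⁅L m, L (-m)⁆ =
    (2 * m : ℂ) • (L 0 + ((1 / 24 : ℂ) * ((m : ℂ) ^ 2 - 1)) • K) := by
  rw [lie_L, if_pos (neg_neg m).symm, add_neg_cancel, smul_add, smul_smul, Int.cast_neg]
  congr 2 <;> ring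

lemma neg_triple {f g h : ℂ[T;T⁻¹]} (hli : LinearIndependent ℂ ![f, g, h]) :
    LinearIndependent ℂ ![-f, -g, -h] := by
  have hv : (LinearEquiv.neg ℂ).toLinearMap ∘ ![f, g, h] = ![-f, -g, -h] := by
    ext i : 1
    fin_cases i <;> rfl
  rw [← hv]
  exact hli.map' _ (LinearEquiv.ker _)

lemma finrank_span_L_triple (α : ℂ) {m : ℤ} (hm : m ≠ 0) :
    Module.finrank ℂ (Submodule.span ℂ {L 0 + α • K, L (-m), L m}) = 3 :=
  finrank_span_triple_of_vecCoord (f := -T 0) (g := -T (-m)) (h := -T m)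
    (neg_triple (linearIndependent_T_triple hm))
    (by rw [map_add, map_smul, vecCoord_K, smul_zero, add_zero, vecCoord_L]) (vecCoord_L _)
    (vecCoord_L m)

lemma isSubalgebraOfDim_three_iff (W : Submodule ℂ Vir) : IsSubalgebraOfDim 3 W ↔
    (∃ m : ℤ, m ≠ 0 ∧
      W = Submodule.span ℂ {L 0 + ((1 / 24 : ℂ) * ((m : ℂ) ^ 2 - 1)) • K, L (-m), L m}) ∨
    (∃ m : ℤ, m ≠ 0 ∧ W = (z m).map incl ⊔ Submodule.span ℂ {K}) ∨
    (∃ μ : Param, W = (s μ).map incl ⊔ Submodule.span ℂ {K}) := by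
  rw [isSubalgebraOfDim_iff]
  simp only [map_z_eq, map_s_eq, map_vec_sup_span_K]
  constructor
  · rintro ⟨hW, h3⟩
    have : FiniteDimensional ℂ W := Module.finite_of_finrank_eq_succ h3
    by_cases hK : K ∈ W
    · right
      have hV2 : Module.finrank ℂ (W.map vecCoord) = 2 := by
        have := finrank_map_vecCoord hK
        lia
      rcases eq_span_of_finrank_two hW.map_vecCoord hV2 with ⟨m, hm, hV⟩ | ⟨μ, hV⟩
      · exact Or.inl ⟨m, hm, by rw [← hV, ← eq_comap_map_vecCoord hK]⟩
      · exact Or.inr ⟨μ, by rw [← hV, ← eq_comap_map_vecCoord hK]⟩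
    · left
      have hV3 : Module.finrank ℂ (W.map vecCoord) = 3 := by
        rw [finrank_map_vecCoord_of_notMem hK, h3]
      obtain ⟨m, hm, hV⟩ := eq_span_of_finrank_three hW.map_vecCoord hV3
      obtain ⟨α, hα⟩ := exists_L_add_smul_K_mem (W := W) (m := 0)
        (hV ▸ Submodule.subset_span (by simp))
      obtain ⟨β, hβ⟩ := exists_L_add_smul_K_mem (W := W) (m := -m)
        (hV ▸ Submodule.subset_span (by simp))
      obtain ⟨γ, hγ⟩ := exists_L_add_smul_K_mem (W := W) (m := m)
        (hV ▸ Submodule.subset_span (by simp))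
      have hn := L_mem_of_add_smul_K_mem hW (neg_ne_zero.2 hm) hα hβ
      have hp := L_mem_of_add_smul_K_mem hW hm hα hγ
      have h0 := hW _ hp _ hn
      rw [lie_L_neg, W.smul_mem_iff (by simpa using hm)] at h0
      refine ⟨m, hm, (Submodule.eq_of_le_of_finrank_eq ?_ ?_).symm⟩
      · rw [Submodule.span_le]
        rintro x (rfl | rfl | rfl)
        exacts [h0, hn, hp]
      · rw [finrank_span_L_triple _ hm, h3]
  · rintro (⟨m, hm, rfl⟩ | ⟨m, hm, rfl⟩ | ⟨μ, rfl⟩)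
    · refine ⟨lieClosed_span ?_, finrank_span_L_triple _ hm⟩
      set c : ℂ := (1 / 24 : ℂ) * ((m : ℂ) ^ 2 - 1) with hc
      set S : Set Vir := {L 0 + c • K, L (-m), L m} with hS
      have hn : L (-m) ∈ Submodule.span ℂ S := Submodule.subset_span (by simp [hS])
      have hp : L m ∈ Submodule.span ℂ S := Submodule.subset_span (by simp [hS])
      have h0 : L 0 + c • K ∈ Submodule.span ℂ S := Submodule.subset_span (by simp [hS])
      have h0L : ∀ k : ℤ, k ≠ 0 → ⁅L 0 + c • K, L k⁆ = (-k : ℂ) • L k := fun k hk => by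
        have := lie_add_smul_K (L 0) (L k) c 0
        rw [zero_smul, add_zero] at this
        rw [this, lie_L, if_neg (by lia), zero_smul, add_zero, zero_add, Int.cast_zero, zero_sub]
      have h0n : ⁅L 0 + c • K, L (-m)⁆ ∈ Submodule.span ℂ S := by
        rw [h0L _ (neg_ne_zero.2 hm)]
        exact Submodule.smul_mem _ _ hn
      have h0p : ⁅L 0 + c • K, L m⁆ ∈ Submodule.span ℂ S := by
        rw [h0L _ hm]
        exact Submodule.smul_mem _ _ hp
      have hpn : ⁅L m, L (-m)⁆ ∈ Submodule.span ℂ S := by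
        rw [lie_L_neg]
        exact Submodule.smul_mem _ _ h0
      rintro x (rfl | rfl | rfl) y (rfl | rfl | rfl)
      · simp only [lie_self, Submodule.zero_mem]
      · exact h0n
      · exact h0p
      · rw [← lie_skew]
        exact Submodule.neg_mem _ h0n
      · simp only [lie_self, Submodule.zero_mem]
      · rw [← lie_skew]
        exact Submodule.neg_mem _ hpn
      · rw [← lie_skew]
        exact Submodule.neg_mem _ h0p
      · exact hpn
      · simp only [lie_self, Submodule.zero_mem]
    · exact ⟨(wrClosed_T_pair m).comap_vecCoord, by
        rw [finrank_comap_of_finrank (finrank_span_pair (linearIndependent_T_pair hm))]⟩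
    · exact ⟨μ.wrClosed.comap_vecCoord, by
        rw [finrank_comap_of_finrank (finrank_span_pair μ.linearIndependent)]⟩

lemma isSubalgebraOfDim_four_iff (W : Submodule ℂ Vir) : IsSubalgebraOfDim 4 W ↔
    ∃ m : ℤ, m ≠ 0 ∧ W = Submodule.span ℂ {L 0, L (-m), L m, K} := by
  rw [isSubalgebraOfDim_iff]
  simp only [span_L_K]
  constructor
  · rintro ⟨hW, h4⟩
    have : FiniteDimensional ℂ W := Module.finite_of_finrank_eq_succ h4
    have h3 := finrank_le_three hW.map_vecCoord
    by_cases hK : K ∈ W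
    · have hV3 : Module.finrank ℂ (W.map vecCoord) = 3 := by
        have := finrank_map_vecCoord hK
        lia
      obtain ⟨m, hm, hV⟩ := eq_span_of_finrank_three hW.map_vecCoord hV3
      exact ⟨m, hm, by rw [← hV, ← eq_comap_map_vecCoord hK]⟩
    -- Without `K`, the projection would be a four-dimensional subalgebra of `𝔡`.
    · rw [finrank_map_vecCoord_of_notMem hK] at h3
      lia
  · rintro ⟨m, hm, rfl⟩
    exact ⟨(wrClosed_T_triple m).comap_vecCoord, by
      rw [finrank_comap_of_finrank (finrank_span_triple (linearIndependent_T_triple hm))]⟩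

end

end Virasoro

theorem mainTheorem2 :
    -- every finite-dimensional subalgebra has dimension at most `4`
    (∀ b : LieSubalgebra ℂ Virasoro.Vir, FiniteDimensional ℂ b → Module.finrank ℂ b ≤ 4) ∧
    -- dimension `1`
    (∀ W : Submodule ℂ Virasoro.Vir, Virasoro.IsSubalgebraOfDim 1 W ↔
      ∃ X : Virasoro.Vir, X ≠ 0 ∧ W = Submodule.span ℂ {X}) ∧
    -- the scalar `β₀`, the second component of `p`, is well defined for every `μ`
    (∀ μ : Virasoro.Param, ∃! p : ℂ × ℂ,
      ⁅Virasoro.incl (μ.P • Virasoro.del), Virasoro.incl (μ.Q • Virasoro.del)⁆ =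
        p.1 • Virasoro.incl (μ.Q • Virasoro.del) + (p.1 * p.2) • Virasoro.K) ∧
    -- dimension `2`
    (∀ W : Submodule ℂ Virasoro.Vir, Virasoro.IsSubalgebraOfDim 2 W ↔
      (∃ X : Virasoro.Witt, X ≠ 0 ∧
        W = Submodule.span ℂ {Virasoro.incl X} ⊔ Submodule.span ℂ {Virasoro.K}) ∨
      (∃ (α : ℂ) (m : ℤ), m ≠ 0 ∧
        W = Submodule.span ℂ {Virasoro.L 0 + α • Virasoro.K, Virasoro.L m}) ∨
      (∃ (μ : Virasoro.Param) (α lam β₀ : ℂ),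
        ⁅Virasoro.incl (μ.P • Virasoro.del), Virasoro.incl (μ.Q • Virasoro.del)⁆ =
          lam • Virasoro.incl (μ.Q • Virasoro.del) + (lam * β₀) • Virasoro.K ∧
        W = Submodule.span ℂ {Virasoro.incl (μ.P • Virasoro.del) + α • Virasoro.K,
          Virasoro.incl (μ.Q • Virasoro.del) + β₀ • Virasoro.K})) ∧
    -- dimension `3`
    (∀ W : Submodule ℂ Virasoro.Vir, Virasoro.IsSubalgebraOfDim 3 W ↔
      (∃ m : ℤ, m ≠ 0 ∧
        W = Submodule.span ℂ {Virasoro.L 0 + ((1 / 24 : ℂ) * ((m : ℂ) ^ 2 - 1)) • Virasoro.K,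
          Virasoro.L (-m), Virasoro.L m}) ∨
      (∃ m : ℤ, m ≠ 0 ∧
        W = (Virasoro.z m).map Virasoro.incl ⊔ Submodule.span ℂ {Virasoro.K}) ∨
      (∃ μ : Virasoro.Param,
        W = (Virasoro.s μ).map Virasoro.incl ⊔ Submodule.span ℂ {Virasoro.K})) ∧
    -- dimension `4`
    (∀ W : Submodule ℂ Virasoro.Vir, Virasoro.IsSubalgebraOfDim 4 W ↔
      ∃ m : ℤ, m ≠ 0 ∧
        W = Submodule.span ℂ {Virasoro.L 0, Virasoro.L (-m), Virasoro.L m, Virasoro.K}) := by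
  refine ⟨fun b hb => ?_, Virasoro.isSubalgebraOfDim_one_iff, Virasoro.Param.existsUnique_lie,
    Virasoro.isSubalgebraOfDim_two_iff, Virasoro.isSubalgebraOfDim_three_iff,
    Virasoro.isSubalgebraOfDim_four_iff⟩
  have : FiniteDimensional ℂ b.toSubmodule := hb
  exact Virasoro.finrank_le_four (W := b.toSubmodule) fun x hx y hy => b.lie_mem hx hy
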